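/- Let $K$ be a field, $S=K[x_1,\ldots,x_n]$, and let $I\subset S$ be a final lexsegment edge ideal, i.e. for some squarefree monomial $v$ of degree $2$, $I$ is generated by all squarefree monomials $w$ of degree $2$ with $w\leq_{lex}v$, where $x_1>_{lex}\cdots>_{lex}x_n$. For $t\geq 1$ let $G(I^t)=\{u_1,\ldots,u_m\}$ be the minimal monomial generators of $I^t$, ordered so that $u_1<_{revlex}\cdots<_{revlex}u_m$; for monomials $a,b$ of the same degree, $a<_{revlex}b$ means that at the largest index $l$ at which the exponents of $a$ and $b$ differ, $x_l$ has the larger exponent in $a$. For a monomial $u\neq 1$ let $\min(u)$ be the least $j$ with $x_j\mid u$, and let $\mathrm{set}(u_i)=\{x_j : x_j\in (u_1,\ldots,u_{i-1}):(u_i)\}$. Let $\beta_i(J)=\dim_K \mathrm{Tor}^S_i(K,J)$ be the $i$-th Betti number of an ideal $J$. (a) For all $t\geq 1$ and all $1\leq i\leq m$, the ideal $(u_1,\ldots,u_{i-1}):(u_i)$ is generated by the variables in $\mathrm{set}(u_i)$, and $$|\mathrm{set}(u_i)|=\begin{cases} n-\min(u_i)-1, & \text{if } x_j^t\mid u_i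 \text{ for some } j>\min(u_i),\\ n-\min(u_i), & \text{otherwise.}\end{cases}$$ (b) If $G(I)=\{u_1,\ldots,u_m\}$ (the case $t=1$), then for all $i\geq 0$ $$\beta_i(I)=\sum_{j=1}^{m}\binom{n-\min(u_j)-1}{i}.$$ (c) For all $t>1$ and $i\geq 0$, with $G(I^t)=\{u_1,\ldots,u_m\}$, $$\beta_i(I^t)=\sum_{j\in B}\binom{n-\min(u_j)}{i}+\sum_{j\in A}\binom{n-\min(u_j)-1}{i},$$ where $A$ is the set of those $j\in\{1,\ldots,m\}$ for which $x_s^t\mid u_j$ for some $s>\min(u_j)$, and $B=\{1,\ldots,m\}\setminus A$. -/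

import Mathlib

open CategoryTheory MvPolynomial

universe u

namespace EdgeIdeal

/-! Monomials of `K[x_1, …, x_n]` are represented by their exponent vectors `w : Fin n →₀ ℕ`;
the variable `x_{i+1}` is `X i` for `i : Fin n`, and divisibility of monomials is the
pointwise order of exponent vectors. -/

section Monomials

variable {n : ℕ}

/-- The monomial `w` is squarefree of degree two. -/
def IsSqfreeDegTwo (w : Fin n →₀ ℕ) : Prop :=
  (∀ i, w i ≤ 1) ∧ w.degree = 2

/-- The final lexsegment set `L^f(v)`: all squarefree monomials `w` of degree two with
`w ≤ v` in the lexicographic order with `x_1 > ⋯ > x_n`. -/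
def finalLexsegment (v : Fin n →₀ ℕ) : Set (Fin n →₀ ℕ) :=
  {w | IsSqfreeDegTwo w ∧ toLex w ≤ toLex v}

/-- Strict reverse lexicographic order with `x_1 > ⋯ > x_n`: the degrees are compared first,
and for equal degrees `a < b` means that at the last variable where the exponents differ
the exponent of `a` is the larger one. -/
def RevlexLT (a b : Fin n →₀ ℕ) : Prop :=
  a.degree < b.degree ∨
    (a.degree = b.degree ∧ ∃ l : Fin n, (∀ s, l < s → a s = b s) ∧ b l < a l)

/-- `min(w)`, the least `j ∈ {1, …, n}` such that `x_j` divides `w ≠ 1`. -/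
noncomputable def minVar (w : Fin n →₀ ℕ) : ℕ :=
  sInf {j | ∃ i : Fin n, w i ≠ 0 ∧ j = (i : ℕ) + 1}

/-- `x_j ^ t` divides `w` for some `j > min(w)`. -/
def HasLaterPower (t : ℕ) (w : Fin n →₀ ℕ) : Prop :=
  ∃ i : Fin n, minVar w < (i : ℕ) + 1 ∧ Finsupp.single i t ≤ w

end Monomials

section Ideals

variable {n : ℕ} {K : Type u} [Field K]

/-- Ideals generated by the final lexsegment set of a squarefree monomial of degree two. -/
def IsFinalLexsegmentEdgeIdeal (I : Ideal (MvPolynomial (Fin n) K)) : Prop :=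
  ∃ v : Fin n →₀ ℕ, IsSqfreeDegTwo v ∧
    I = Ideal.span ((fun w => monomial w (1 : K)) '' finalLexsegment v)

/-- `G(J)`, the minimal monomial generators of a monomial ideal `J`: the monomials in `J`
that are minimal with respect to divisibility. -/
def minGens (J : Ideal (MvPolynomial (Fin n) K)) : Set (Fin n →₀ ℕ) :=
  {w | Minimal (fun w' => monomial w' (1 : K) ∈ J) w}

/-- `G(J) = {u_1, …, u_m}` with `u_1 < ⋯ < u_m` in the reverse lexicographic order. -/
def IsRevlexEnumeration (J : Ideal (MvPolynomial (Fin n) K)) {m : ℕ}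
    (w : Fin m → Fin n →₀ ℕ) : Prop :=
  (∀ a b : Fin m, a < b → RevlexLT (w a) (w b)) ∧ Set.range w = minGens J

variable (K)

/-- The colon ideal `(u_1, …, u_{a-1}) : (u_a)`. -/
noncomputable def colonIdeal {m : ℕ} (w : Fin m → Fin n →₀ ℕ) (a : Fin m) :
    Ideal (MvPolynomial (Fin n) K) :=
  Submodule.colon
    (Ideal.span {f | ∃ b : Fin m, b < a ∧ f = monomial (w b) (1 : K)})
    (Ideal.span {monomial (w a) (1 : K)} : Ideal (MvPolynomial (Fin n) K))

/-- `set(u_a)`, given by the indices of the variables in `(u_1, …, u_{a-1}) : (u_a)`. -/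
def quotientSet {m : ℕ} (w : Fin m → Fin n →₀ ℕ) (a : Fin m) : Set (Fin n) :=
  {j | (X j : MvPolynomial (Fin n) K) ∈ colonIdeal K w a}

/-- The residue field `K = S / (x_1, …, x_n)` as a module over `S = K[x_1, …, x_n]`. -/
noncomputable abbrev residueModule (n : ℕ) (K : Type u) [Field K] :
    ModuleCat.{u} (MvPolynomial (Fin n) K) :=
  ModuleCat.of (MvPolynomial (Fin n) K)
    (MvPolynomial (Fin n) K ⧸
      (Ideal.span (Set.range (X : Fin n → MvPolynomial (Fin n) K))))

variable {K}

/-- The Betti number `β_i(I) = dim_K Tor_i^S(K, I)`, the rank of the `i`-th module in a minimal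
graded free resolution of `I`. It is a cardinal, so that no junk value occurs. -/
noncomputable def bettiNumber (I : Ideal (MvPolynomial (Fin n) K)) (i : ℕ) : Cardinal.{u} :=
  Module.rank K
    ((ModuleCat.restrictScalars (algebraMap K (MvPolynomial (Fin n) K))).obj
      (((Tor (ModuleCat.{u} (MvPolynomial (Fin n) K)) i).obj (residueModule n K)).obj
        (ModuleCat.of (MvPolynomial (Fin n) K) I)))

end Ideals

end EdgeIdeal

namespace CategoryTheory

section Horseshoe

open Limits HomologicalComplex

universe v' u' v'' u''

variable {C : Type u'} [Category.{v'} C] [Abelian C]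

/-- The augmentation of a projective resolution, as a map to the resolved object. -/
noncomputable def ProjectiveResolution.aug {Z : C} (P : ProjectiveResolution Z) :
    P.complex.X 0 ⟶ Z :=
  P.π.f 0

instance {Z : C} (P : ProjectiveResolution Z) : Epi P.aug :=
  inferInstanceAs (Epi (P.π.f 0))

lemma ProjectiveResolution.d_comp_aug {Z : C} (P : ProjectiveResolution Z) :
    P.complex.d 1 0 ≫ P.aug = 0 :=
  P.complex_d_comp_π_f_zero

lemma ProjectiveResolution.exact_aug {Z : C} (P : ProjectiveResolution Z) :
    (ShortComplex.mk _ _ P.d_comp_aug).Exact :=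
  P.exact₀

/-- A degreewise family of maps `θ : R_{n+1} ⟶ P_n` and an augmentation `s : R_0 ⟶ B` from
which the middle complex in the horseshoe lemma is built. -/
structure HorseshoeData (S : ShortComplex C) (P : ProjectiveResolution S.X₁)
    (R : ProjectiveResolution S.X₃) where
  /-- the lift of the augmentation of `R` -/
  s : R.complex.X 0 ⟶ S.X₂
  s_g : s ≫ S.g = R.aug
  /-- the off-diagonal part of the differential -/
  θ : ∀ n, R.complex.X (n + 1) ⟶ P.complex.X n
  θ_zero : θ 0 ≫ P.aug ≫ S.f + R.complex.d 1 0 ≫ s = 0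
  θ_succ : ∀ n, θ (n + 1) ≫ P.complex.d (n + 1) n + R.complex.d (n + 2) (n + 1) ≫ θ n = 0

lemma exists_horseshoeData {S : ShortComplex C} (hS : S.ShortExact)
    (P : ProjectiveResolution S.X₁) (R : ProjectiveResolution S.X₃) :
    Nonempty (HorseshoeData S P R) := by
  have := hS.mono_f
  have := hS.epi_g
  let s : R.complex.X 0 ⟶ S.X₂ := Projective.factorThru R.aug S.g
  have hs : s ≫ S.g = R.aug := Projective.factorThru_comp _ _
  let l : R.complex.X 1 ⟶ S.X₁ := hS.exact.lift (R.complex.d 1 0 ≫ s) (by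
    rw [Category.assoc, hs, R.d_comp_aug])
  have hl : l ≫ S.f = R.complex.d 1 0 ≫ s := hS.exact.lift_f _ _
  let z : R.complex.X 1 ⟶ P.complex.X 0 := Projective.factorThru l P.aug
  have hz : z ≫ P.aug = l := Projective.factorThru_comp _ _
  have hdl : R.complex.d 2 1 ≫ l = 0 := by
    rw [← cancel_mono S.f, Category.assoc, hl]; simp
  let o : R.complex.X 2 ⟶ P.complex.X 1 := P.exact_aug.liftFromProjective (R.complex.d 2 1 ≫ z)
    (by dsimp; rw [Category.assoc, hz, hdl])
  have ho : o ≫ P.complex.d 1 0 = R.complex.d 2 1 ≫ z :=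
    P.exact_aug.liftFromProjective_comp _ _
  let succ : ∀ (n : ℕ) (f : R.complex.X (n + 1) ⟶ P.complex.X n)
      (f' : R.complex.X (n + 2) ⟶ P.complex.X (n + 1)),
      f' ≫ P.complex.d (n + 1) n = R.complex.d (n + 2) (n + 1) ≫ f →
      Σ' f'' : R.complex.X (n + 3) ⟶ P.complex.X (n + 2),
        f'' ≫ P.complex.d (n + 2) (n + 1) = R.complex.d (n + 3) (n + 2) ≫ f' :=
    fun n f f' w => ⟨(P.exact_succ n).liftFromProjective
      (R.complex.d (n + 3) (n + 2) ≫ f') (by dsimp; rw [Category.assoc, w]; simp),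
      (P.exact_succ n).liftFromProjective_comp _ _⟩
  obtain ⟨φ, hφ₀, hφ⟩ : ∃ φ : ∀ n, R.complex.X (n + 1) ⟶ P.complex.X n, φ 0 = z ∧
      ∀ n, φ (n + 1) ≫ P.complex.d (n + 1) n = R.complex.d (n + 2) (n + 1) ≫ φ n := by
    let ψ : ChainComplex.truncate.obj R.complex ⟶ P.complex :=
      ChainComplex.mkHom _ _ z o ho fun n p => succ n p.1 p.2.1 p.2.2
    exact ⟨ψ.f, rfl, fun n => ψ.comm (n + 1) n⟩
  refine ⟨⟨s, hs, fun n => ((-1 : ℤ) ^ (n + 1)) • φ n, ?_, fun n => ?_⟩⟩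
  · rw [hφ₀, Preadditive.zsmul_comp, ← Category.assoc, hz, hl]
    simp
  · rw [Preadditive.zsmul_comp, Preadditive.comp_zsmul, hφ, ← add_smul, pow_succ _ (n + 1)]
    simp

namespace HorseshoeData

variable {S : ShortComplex C} {P : ProjectiveResolution S.X₁} {R : ProjectiveResolution S.X₃}
  (D : HorseshoeData S P R)

/-- The differential of the middle complex. -/
noncomputable def d (n : ℕ) : P.complex.X (n + 1) ⊞ R.complex.X (n + 1) ⟶
    P.complex.X n ⊞ R.complex.X n :=
  biprod.desc (P.complex.d (n + 1) n ≫ biprod.inl)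
    (D.θ n ≫ biprod.inl + R.complex.d (n + 1) n ≫ biprod.inr)

lemma d_comp_d (n : ℕ) : D.d (n + 1) ≫ D.d n = 0 := by
  apply biprod.hom_ext'
  · simp [d]
  · have := D.θ_succ n
    simp only [d, biprod.inr_desc_assoc, Preadditive.add_comp, Category.assoc, biprod.inl_desc,
      biprod.inr_desc, Preadditive.comp_add, HomologicalComplex.d_comp_d_assoc, zero_comp,
      add_zero, comp_zero]
    rw [← Category.assoc, ← Category.assoc, ← Preadditive.add_comp, this, zero_comp]

/-- The augmentation of the middle complex. -/
noncomputable def aug : P.complex.X 0 ⊞ R.complex.X 0 ⟶ S.X₂ :=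
  biprod.desc (P.aug ≫ S.f) D.s

lemma d_comp_aug : D.d 0 ≫ D.aug = 0 := by
  apply biprod.hom_ext'
  · have := P.d_comp_aug
    simp [d, aug, reassoc_of% this]
  · have := D.θ_zero
    simpa [d, aug] using this

/-- The middle complex of the horseshoe lemma. -/
noncomputable def complex : ChainComplex C ℕ :=
  ChainComplex.of (fun n => P.complex.X n ⊞ R.complex.X n) D.d D.d_comp_d

lemma complex_d (n : ℕ) : D.complex.d (n + 1) n = D.d n :=
  ChainComplex.of_d (fun n => P.complex.X n ⊞ R.complex.X n) D.d n

/-- The inclusion of the first resolution. -/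
noncomputable def inl : P.complex ⟶ D.complex where
  f n := biprod.inl (X := P.complex.X n) (Y := R.complex.X n)
  comm' := by
    rintro _ n rfl
    rw [complex_d]
    exact biprod.inl_desc _ _

/-- The projection to the second resolution. -/
noncomputable def snd : D.complex ⟶ R.complex where
  f n := biprod.snd (X := P.complex.X n) (Y := R.complex.X n)
  comm' := by
    rintro _ n rfl
    rw [complex_d]
    have : biprod.snd ≫ R.complex.d (n + 1) n = D.d n ≫ biprod.snd := by
      apply biprod.hom_ext' <;> simp [d]
    exact this

/-- The augmentation of the middle complex as a chain map. -/
noncomputable def π : D.complex ⟶ (ChainComplex.single₀ C).obj S.X₂ :=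
  (ChainComplex.toSingle₀Equiv D.complex S.X₂).symm ⟨D.aug, by
    rw [complex_d]; exact D.d_comp_aug⟩

lemma π_f_zero : D.π.f 0 = D.aug :=
  ChainComplex.toSingle₀Equiv_symm_apply_f_zero _ _

lemma inl_f_comp_π_f : D.inl.f 0 ≫ D.π.f 0 = P.π.f 0 ≫ S.f := by
  rw [π_f_zero]
  exact biprod.inl_desc _ _

lemma snd_f_comp_π_f : D.snd.f 0 ≫ R.π.f 0 = D.π.f 0 ≫ S.g := by
  rw [π_f_zero]
  have : biprod.snd ≫ R.aug = D.aug ≫ S.g := by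
    apply biprod.hom_ext' <;> simp [aug, D.s_g]
  exact this

lemma inl_π : D.inl ≫ D.π = P.π ≫ (ChainComplex.single₀ C).map S.f :=
  HomologicalComplex.to_single_hom_ext (D.inl_f_comp_π_f.trans (by simp))

lemma snd_π : D.snd ≫ R.π = D.π ≫ (ChainComplex.single₀ C).map S.g :=
  HomologicalComplex.to_single_hom_ext (D.snd_f_comp_π_f.trans (by simp))

/-- The short complex of complexes in the horseshoe lemma. -/
noncomputable def shortComplex : ShortComplex (ChainComplex C ℕ) :=
  ShortComplex.mk D.inl D.snd (by
    ext n
    exact biprod.inl_snd)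

/-- The short complex of complexes in the horseshoe lemma is degreewise split. -/
noncomputable def splitting (n : ℕ) :
    (D.shortComplex.map (HomologicalComplex.eval C (ComplexShape.down ℕ) n)).Splitting :=
  ShortComplex.Splitting.ofHasBinaryBiproduct (P.complex.X n) (R.complex.X n)

lemma shortExact : D.shortComplex.ShortExact :=
  HomologicalComplex.shortExact_of_degreewise_shortExact _ fun n => (D.splitting n).shortExact

lemma quasiIso_π (hS : S.ShortExact) : QuasiIso D.π := by
  have hT : (S.map (ChainComplex.single₀ C)).ShortExact := hS.map_of_exact _
  let φ : D.shortComplex ⟶ S.map (ChainComplex.single₀ C) :=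
    { τ₁ := P.π
      τ₂ := D.π
      τ₃ := R.π
      comm₁₂ := D.inl_π.symm
      comm₂₃ := D.snd_π.symm }
  rw [quasiIso_iff]
  rintro (_ | n)
  · rw [quasiIsoAt_iff_isIso_homologyMap]
    have key : ∀ T : ShortComplex (ChainComplex C ℕ), T.ShortExact → T.X₃.ExactAt 1 →
        (T.map (homologyFunctor C (ComplexShape.down ℕ) 0)).ShortExact := by
      intro T h h3
      have := h.mono_f
      have := h.epi_g
      have e : Epi (homologyMap T.g 0) :=
        epi_homologyMap_of_epi_of_not_rel _ _ (by simp)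
      have m : Mono (homologyMap T.f 0) :=
        (h.homology_exact₁ 1 0 rfl).mono_g
          ((exactAt_iff_isZero_homology _ _).1 h3 |>.eq_of_src _ _)
      exact { exact := h.homology_exact₂ 0, mono_f := m, epi_g := e }
    have k1 := key _ D.shortExact (R.complex_exactAt_succ 0)
    have k2 := key _ hT (ChainComplex.exactAt_succ_single_obj _ _)
    let ψ := (homologyFunctor C (ComplexShape.down ℕ) 0).mapShortComplex.map φ
    have i1 : IsIso ψ.τ₁ := inferInstanceAs (IsIso (homologyMap P.π 0))
    have i3 : IsIso ψ.τ₃ := inferInstanceAs (IsIso (homologyMap R.π 0))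
    exact ShortComplex.isIso₂_of_shortExact_of_isIso₁₃ ψ k1 k2
  · rw [quasiIsoAt_iff_exactAt' _ _ (ChainComplex.exactAt_succ_single_obj _ _)]
    exact D.shortExact.exactAt_X₂ _ (P.complex_exactAt_succ n) (R.complex_exactAt_succ n)

/-- The projective resolution of the middle term in the horseshoe lemma. -/
noncomputable def resolution (hS : S.ShortExact) : ProjectiveResolution S.X₂ where
  complex := D.complex
  projective n := inferInstanceAs (Projective (P.complex.X n ⊞ R.complex.X n))
  π := D.π
  quasiIso := D.quasiIso_π hS

end HorseshoeData

variable [HasProjectiveResolutions C] {A : Type u''} [Category.{v''} A] [Abelian A]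

/-- The long exact sequence of left derived functors. -/
theorem exists_leftDerived_longExact (F : C ⥤ A) [F.Additive] {S : ShortComplex C}
    (hS : S.ShortExact) :
    ∃ δ : ∀ n, (F.leftDerived (n + 1)).obj S.X₃ ⟶ (F.leftDerived n).obj S.X₁,
      (∀ n, ∃ w : (F.leftDerived n).map S.f ≫ (F.leftDerived n).map S.g = 0,
        (ShortComplex.mk _ _ w).Exact) ∧
      (∀ n, ∃ w : (F.leftDerived (n + 1)).map S.g ≫ δ n = 0, (ShortComplex.mk _ _ w).Exact) ∧
      (∀ n, ∃ w : δ n ≫ (F.leftDerived n).map S.f = 0, (ShortComplex.mk _ _ w).Exact) ∧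
      Epi ((F.leftDerived 0).map S.g) := by
  let P := projectiveResolution S.X₁
  let R := projectiveResolution S.X₃
  obtain ⟨D⟩ := exists_horseshoeData hS P R
  let Q := D.resolution hS
  let T := D.shortComplex.map (F.mapHomologicalComplex (ComplexShape.down ℕ))
  have hT : T.ShortExact :=
    HomologicalComplex.shortExact_of_degreewise_shortExact _ fun n =>
      ((D.splitting n).map F).shortExact
  have hr : ∀ n, (ComplexShape.down ℕ).Rel (n + 1) n := fun n => rfl
  let e₁ : ∀ n, (F.leftDerived n).obj S.X₁ ≅ T.X₁.homology n := fun n => P.isoLeftDerivedObj F n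
  let e₂ : ∀ n, (F.leftDerived n).obj S.X₂ ≅ T.X₂.homology n := fun n => Q.isoLeftDerivedObj F n
  let e₃ : ∀ n, (F.leftDerived n).obj S.X₃ ≅ T.X₃.homology n := fun n => R.isoLeftDerivedObj F n
  have hf : ∀ n, (F.leftDerived n).map S.f ≫ (e₂ n).hom = (e₁ n).hom ≫ homologyMap T.f n :=
    fun n => ProjectiveResolution.isoLeftDerivedObj_hom_naturality S.f P Q D.inl
      D.inl_f_comp_π_f F n
  have hg : ∀ n, (F.leftDerived n).map S.g ≫ (e₃ n).hom = (e₂ n).hom ≫ homologyMap T.g n :=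
    fun n => ProjectiveResolution.isoLeftDerivedObj_hom_naturality S.g Q R D.snd
      D.snd_f_comp_π_f F n
  let δ : ∀ n, (F.leftDerived (n + 1)).obj S.X₃ ⟶ (F.leftDerived n).obj S.X₁ :=
    fun n => (e₃ (n + 1)).hom ≫ hT.δ (n + 1) n (hr n) ≫ (e₁ n).inv
  have hδ : ∀ n, δ n ≫ (e₁ n).hom = (e₃ (n + 1)).hom ≫ hT.δ (n + 1) n (hr n) := fun n => by
    dsimp only [δ]
    rw [Category.assoc, Category.assoc, Iso.inv_hom_id, Category.comp_id]
  have w : ∀ n, (F.leftDerived n).map S.f ≫ (F.leftDerived n).map S.g = 0 := fun n => by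
    rw [← cancel_mono (e₃ n).hom, Category.assoc, hg, ← Category.assoc, hf, Category.assoc,
      ← homologyMap_comp, T.zero, homologyMap_zero, comp_zero, zero_comp]
  have w₁ : ∀ n, (F.leftDerived (n + 1)).map S.g ≫ δ n = 0 := fun n => by
    rw [← cancel_mono (e₁ n).hom, Category.assoc, hδ, ← Category.assoc, hg, Category.assoc,
      hT.comp_δ, comp_zero, zero_comp]
  have w₂ : ∀ n, δ n ≫ (F.leftDerived n).map S.f = 0 := fun n => by
    rw [← cancel_mono (e₂ n).hom, Category.assoc, hf, ← Category.assoc, hδ, Category.assoc,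
      hT.δ_comp, comp_zero, zero_comp]
  refine ⟨δ, fun n => ⟨w n, ?_⟩, fun n => ⟨w₁ n, ?_⟩, fun n => ⟨w₂ n, ?_⟩, ?_⟩
  · let i : ShortComplex.mk _ _ (w n) ≅ ShortComplex.mk (homologyMap T.f n) (homologyMap T.g n)
        (by rw [← homologyMap_comp, T.zero, homologyMap_zero]) :=
      ShortComplex.isoMk (e₁ n) (e₂ n) (e₃ n) (hf n).symm (hg n).symm
    exact (ShortComplex.exact_iff_of_iso i).2 (hT.homology_exact₂ n)
  · let i : ShortComplex.mk _ _ (w₁ n) ≅ ShortComplex.mk _ _ (hT.comp_δ (n + 1) n (hr n)) :=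
      ShortComplex.isoMk (e₂ (n + 1)) (e₃ (n + 1)) (e₁ n) (hg (n + 1)).symm (hδ n).symm
    exact (ShortComplex.exact_iff_of_iso i).2 (hT.homology_exact₃ (n + 1) n (hr n))
  · let i : ShortComplex.mk _ _ (w₂ n) ≅ ShortComplex.mk _ _ (hT.δ_comp (n + 1) n (hr n)) :=
      ShortComplex.isoMk (e₃ (n + 1)) (e₁ n) (e₂ n) (hδ n).symm (hf n).symm
    exact (ShortComplex.exact_iff_of_iso i).2 (hT.homology_exact₁ (n + 1) n (hr n))
  · have := hT.epi_g
    have e : Epi (homologyMap T.g 0) := epi_homologyMap_of_epi_of_not_rel _ _ (by simp)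
    have : (F.leftDerived 0).map S.g = ((e₂ 0).hom ≫ homologyMap T.g 0) ≫ (e₃ 0).inv := by
      rw [← cancel_mono (e₃ 0).hom, hg, Category.assoc, Iso.inv_hom_id, Category.comp_id]
    rw [this]
    exact epi_comp' (epi_comp' inferInstance e) inferInstance

end Horseshoe
end CategoryTheory

namespace CategoryTheory

/-- The zeroth left derived functor of `F` agrees with `F` on projective objects. -/
noncomputable def leftDerivedZeroObjIso {C D : Type*} [Category* C] [Category* D] [Abelian C]
    [HasProjectiveResolutions C] [Abelian D] (F : C ⥤ D) [F.Additive] (P : C) [Projective P] :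
    (F.leftDerived 0).obj P ≅ F.obj P :=
  asIso (F.fromLeftDerivedZero.app P)

end CategoryTheory

namespace EdgeIdeal

section Tor

variable {n : ℕ} {K : Type u} [Field K]

variable (n K) in
/-- The homogeneous maximal ideal of the polynomial ring. -/
noncomputable abbrev irrelevantIdeal : Ideal (MvPolynomial (Fin n) K) :=
  Ideal.span (Set.range (X : Fin n → MvPolynomial (Fin n) K))

variable (n K) in
/-- The functor `M ↦ Tor_i(K, M)`. -/
noncomputable abbrev torResidue (i : ℕ) :
    ModuleCat.{u} (MvPolynomial (Fin n) K) ⥤ ModuleCat.{u} (MvPolynomial (Fin n) K) :=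
  (Tor (ModuleCat.{u} (MvPolynomial (Fin n) K)) i).obj (residueModule n K)

/-- The dimension over `K` of a module over the polynomial ring. -/
noncomputable abbrev dimK (M : ModuleCat.{u} (MvPolynomial (Fin n) K)) : Cardinal.{u} :=
  Module.rank K ((ModuleCat.restrictScalars (algebraMap K (MvPolynomial (Fin n) K))).obj M)

lemma dimK_eq_add {A B C : ModuleCat.{u} (MvPolynomial (Fin n) K)} (f : A ⟶ B) (g : B ⟶ C)
    (hf : Function.Injective f) (h : Function.Exact f g) (hg : Function.Surjective g) :
    dimK B = dimK A + dimK C := by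
  let F := ((ModuleCat.restrictScalars (algebraMap K (MvPolynomial (Fin n) K))).map f).hom
  let G := ((ModuleCat.restrictScalars (algebraMap K (MvPolynomial (Fin n) K))).map g).hom
  have hF : Function.Injective F := hf
  have hG : Function.Surjective G := hg
  have hFG : Function.Exact F G := h
  have h1 := LinearMap.rank_range_add_rank_ker G
  rw [hFG.linearMap_ker_eq, LinearMap.range_eq_top.2 hG, rank_top] at h1
  rw [← (LinearEquiv.ofInjective F hF).rank_eq] at h1
  rw [dimK, ← h1, add_comm]

lemma dimK_congr {A B : ModuleCat.{u} (MvPolynomial (Fin n) K)} (e : A ≅ B) :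
    dimK A = dimK B :=
  ((ModuleCat.restrictScalars (algebraMap K
    (MvPolynomial (Fin n) K))).mapIso e).toLinearEquiv.rank_eq

lemma smul_residueModule_eq_zero {x : MvPolynomial (Fin n) K} (hx : x ∈ irrelevantIdeal n K)
    (y : residueModule n K) : x • y = 0 := by
  obtain ⟨y, rfl⟩ := Ideal.Quotient.mk_surjective y
  exact Ideal.Quotient.eq_zero_iff_mem.2 (Ideal.mul_mem_right y _ hx)

lemma torResidue_map_smul {x : MvPolynomial (Fin n) K} (hx : x ∈ irrelevantIdeal n K)
    (M : ModuleCat.{u} (MvPolynomial (Fin n) K)) (i : ℕ) :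
    (torResidue n K i).map (x • 𝟙 M) = 0 := by
  let P := projectiveResolution M
  let F := (MonoidalCategory.tensoringLeft
    (ModuleCat.{u} (MvPolynomial (Fin n) K))).obj (residueModule n K)
  have key : (F.mapHomologicalComplex (ComplexShape.down ℕ)).map (x • 𝟙 P.complex) = 0 := by
    ext j : 1
    change F.map ((x • 𝟙 P.complex : P.complex ⟶ P.complex).f j) = 0
    have : (x • 𝟙 P.complex : P.complex ⟶ P.complex).f j = x • 𝟙 (P.complex.X j) := rfl
    rw [this]
    apply ModuleCat.hom_ext
    apply TensorProduct.ext'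
    intro k p
    change k ⊗ₜ[MvPolynomial (Fin n) K] (x • p) = 0
    rw [← TensorProduct.smul_tmul, smul_residueModule_eq_zero hx, TensorProduct.zero_tmul]
  have := F.leftDerived_map_eq i (x • 𝟙 M) (P := P) (Q := P) (x • 𝟙 P.complex) (by
    apply HomologicalComplex.to_single_hom_ext
    rw [HomologicalComplex.comp_f, HomologicalComplex.comp_f, ChainComplex.single₀_map_f_zero]
    exact (Linear.smul_comp _ _ _ _ _ _).trans (by
      rw [HomologicalComplex.id_f, Category.id_comp]
      exact ((Linear.comp_smul _ _ _ (P.π.f 0) x (𝟙 M)).trans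
        (congrArg _ (Category.comp_id _))).symm))
  change (F.leftDerived i).map (x • 𝟙 M) = 0
  rw [this, Functor.comp_map, key, Functor.map_zero]
  exact (congrArg _ Limits.zero_comp).trans Limits.comp_zero

lemma torResidue_longExact {A B C : ModuleCat.{u} (MvPolynomial (Fin n) K)} (f : A ⟶ B) (g : B ⟶ C)
    (hf : Function.Injective f) (h : Function.Exact f g) (hg : Function.Surjective g) :
    ∃ δ : ∀ i, (torResidue n K (i + 1)).obj C ⟶ (torResidue n K i).obj A,
      (∀ i, Function.Exact ((torResidue n K i).map f) ((torResidue n K i).map g)) ∧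
      (∀ i, Function.Exact ((torResidue n K (i + 1)).map g) (δ i)) ∧
      (∀ i, Function.Exact (δ i) ((torResidue n K i).map f)) ∧
      Function.Surjective ((torResidue n K 0).map g) := by
  let S : ShortComplex (ModuleCat.{u} (MvPolynomial (Fin n) K)) :=
    ShortComplex.mk f g (by ext x; exact h.apply_apply_eq_zero x)
  have hS : S.ShortExact :=
    { exact := (ShortComplex.ShortExact.moduleCat_exact_iff_function_exact S).2 h
      mono_f := (ModuleCat.mono_iff_injective f).2 hf
      epi_g := (ModuleCat.epi_iff_surjective g).2 hg }
  obtain ⟨δ, h1, h2, h3, h4⟩ := exists_leftDerived_longExact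
    ((MonoidalCategory.tensoringLeft
    (ModuleCat.{u} (MvPolynomial (Fin n) K))).obj (residueModule n K)) hS
  refine ⟨δ, fun i => ?_, fun i => ?_, fun i => ?_, (ModuleCat.epi_iff_surjective _).1 h4⟩
  · obtain ⟨w, h⟩ := h1 i
    exact (ShortComplex.ShortExact.moduleCat_exact_iff_function_exact _).1 h
  · obtain ⟨w, h⟩ := h2 i
    exact (ShortComplex.ShortExact.moduleCat_exact_iff_function_exact _).1 h
  · obtain ⟨w, h⟩ := h3 i
    exact (ShortComplex.ShortExact.moduleCat_exact_iff_function_exact _).1 h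

lemma dimK_torResidue_of_injective {A B C : ModuleCat.{u} (MvPolynomial (Fin n) K)}
    (f : A ⟶ B) (g : B ⟶ C)
    (hf : Function.Injective f) (h : Function.Exact f g) (hg : Function.Surjective g)
    (hT : ∀ i, Function.Injective ((torResidue n K i).map f)) (i : ℕ) :
    dimK ((torResidue n K i).obj B) =
      dimK ((torResidue n K i).obj A) + dimK ((torResidue n K i).obj C) := by
  obtain ⟨δ, h1, h2, h3, h4⟩ := torResidue_longExact f g hf h hg
  refine dimK_eq_add _ _ (hT i) (h1 i) ?_
  cases i with
  | zero => exact h4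
  | succ i =>
    intro c
    refine (h2 i c).1 (hT i ?_)
    rw [(h3 i).apply_apply_eq_zero, map_zero]

lemma torResidue_of_eq_zero {A B C : ModuleCat.{u} (MvPolynomial (Fin n) K)}
    (f : A ⟶ B) (g : B ⟶ C)
    (hf : Function.Injective f) (h : Function.Exact f g) (hg : Function.Surjective g)
    (hT : ∀ i, (torResidue n K i).map f = 0) :
    (∀ i, Function.Injective ((torResidue n K i).map g)) ∧
    dimK ((torResidue n K 0).obj C) = dimK ((torResidue n K 0).obj B) ∧
    ∀ i, dimK ((torResidue n K (i + 1)).obj C) =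
      dimK ((torResidue n K (i + 1)).obj B) + dimK ((torResidue n K i).obj A) := by
  obtain ⟨δ, h1, h2, h3, h4⟩ := torResidue_longExact f g hf h hg
  have hinj : ∀ i, Function.Injective ((torResidue n K i).map g) := by
    intro i
    refine (injective_iff_map_eq_zero ((torResidue n K i).map g).hom).2 fun b hb => ?_
    obtain ⟨a, rfl⟩ := (h1 i b).1 hb
    rw [hT i]
    rfl
  refine ⟨hinj, ?_, fun i => dimK_eq_add _ _ (hinj _) (h2 i) fun a => (h3 i a).1 ?_⟩
  · exact (dimK_congr (LinearEquiv.ofBijective ((torResidue n K 0).map g).hom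
      ⟨hinj 0, h4⟩).toModuleIso).symm
  · rw [hT i]
    rfl

lemma sub_C_constantCoeff_mem (p : MvPolynomial (Fin n) K) :
    p - C (constantCoeff p) ∈ irrelevantIdeal n K := by
  rw [irrelevantIdeal, ← Set.image_univ, mem_ideal_span_X_image]
  intro m hm
  by_contra! hc
  have : m = 0 := Finsupp.ext fun i => hc i (Set.mem_univ i)
  subst this
  simp [constantCoeff_eq] at hm

variable (n K) in
lemma dimK_residueModule : dimK (residueModule n K) = 1 := by
  refine rank_eq_one (1 : MvPolynomial (Fin n) K ⧸ irrelevantIdeal n K) ?_ ?_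
  · intro h
    have h1 : (1 : MvPolynomial (Fin n) K) ∈ irrelevantIdeal n K :=
      Ideal.Quotient.eq_zero_iff_mem.1 h
    have : irrelevantIdeal n K ≤ RingHom.ker (constantCoeff (R := K) (σ := Fin n)) := by
      rw [Ideal.span_le]
      rintro _ ⟨i, rfl⟩
      simp
    simpa using this h1
  · intro v
    obtain ⟨p, rfl⟩ := Ideal.Quotient.mk_surjective v
    refine ⟨constantCoeff p, ?_⟩
    change Ideal.Quotient.mk (irrelevantIdeal n K) (C (constantCoeff p) * 1) =
      Ideal.Quotient.mk (irrelevantIdeal n K) p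
    rw [mul_one, eq_comm, Ideal.Quotient.eq]
    exact sub_C_constantCoeff_mem p

lemma dimK_torResidue_self (i : ℕ) :
    dimK ((torResidue n K i).obj (ModuleCat.of _ (MvPolynomial (Fin n) K))) =
      (Nat.choose 0 i : ℕ) := by
  have : Projective (ModuleCat.of (MvPolynomial (Fin n) K) (MvPolynomial (Fin n) K)) :=
    ModuleCat.projective_of_free (Module.Free.chooseBasis _ _)
  let F := (MonoidalCategory.tensoringLeft
    (ModuleCat.{u} (MvPolynomial (Fin n) K))).obj (residueModule n K)
  cases i with
  | zero =>
    have e : F.obj (ModuleCat.of _ (MvPolynomial (Fin n) K)) ≅ residueModule n K :=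
      MonoidalCategory.rightUnitor (residueModule n K)
    have e' : (torResidue n K 0).obj (ModuleCat.of _ (MvPolynomial (Fin n) K)) ≅
      residueModule n K := leftDerivedZeroObjIso F _ ≪≫ e
    rw [dimK_congr e', dimK_residueModule]
    simp
  | succ i =>
    have := isZero_Tor_succ_of_projective _ (residueModule n K)
      (ModuleCat.of (MvPolynomial (Fin n) K) (MvPolynomial (Fin n) K)) i
    have hs := ModuleCat.subsingleton_of_isZero this
    rw [Nat.choose_zero_succ, Nat.cast_zero]
    exact @rank_subsingleton' K _ _ _ _ _ hs

end Tor
end EdgeIdeal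

namespace EdgeIdeal

section LinearQuotients

variable {n : ℕ} {K : Type u} [Field K]

section Modules

variable {M N P V W : Type u} [AddCommGroup M] [Module (MvPolynomial (Fin n) K) M]
  [AddCommGroup N] [Module (MvPolynomial (Fin n) K) N]
  [AddCommGroup P] [Module (MvPolynomial (Fin n) K) P]
  [AddCommGroup V] [Module (MvPolynomial (Fin n) K) V]
  [AddCommGroup W] [Module (MvPolynomial (Fin n) K) W]

/-- The map induced on `Tor_i(K, -)` by a linear map. -/
noncomputable abbrev torMap (i : ℕ) (f : M →ₗ[MvPolynomial (Fin n) K] N) :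
    (torResidue n K i).obj (ModuleCat.of (MvPolynomial (Fin n) K) M) ⟶
      (torResidue n K i).obj (ModuleCat.of (MvPolynomial (Fin n) K) N) :=
  (torResidue n K i).map (ModuleCat.ofHom f)

lemma torMap_comp (i : ℕ) (f : M →ₗ[MvPolynomial (Fin n) K] N)
    (g : N →ₗ[MvPolynomial (Fin n) K] P)
    (z : (torResidue n K i).obj (ModuleCat.of (MvPolynomial (Fin n) K) M)) :
    torMap i (g ∘ₗ f) z = torMap i g (torMap i f z) := by
  rw [torMap, ModuleCat.ofHom_comp, Functor.map_comp]
  rfl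

lemma torMap_injective_of_leftInverse (i : ℕ) (f : M →ₗ[MvPolynomial (Fin n) K] N)
    (g : N →ₗ[MvPolynomial (Fin n) K] M)
    (h : g ∘ₗ f = LinearMap.id) : Function.Injective (torMap i f) := by
  refine Function.LeftInverse.injective (g := torMap i g) fun z => ?_
  rw [← torMap_comp, h, torMap, ModuleCat.ofHom_id, CategoryTheory.Functor.map_id]
  rfl

/-- An injective map into a module killed by the irrelevant ideal splits. -/
lemma exists_leftInverse_of_smul_eq_zero (f : V →ₗ[MvPolynomial (Fin n) K] W)
    (hf : Function.Injective f)
    (hW : ∀ x ∈ irrelevantIdeal n K, ∀ w : W, x • w = 0) :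
    ∃ g : W →ₗ[MvPolynomial (Fin n) K] V, g ∘ₗ f = LinearMap.id := by
  have hV : ∀ x ∈ irrelevantIdeal n K, ∀ v : V, x • v = 0 := fun x hx v =>
    hf (by rw [map_smul, hW x hx, map_zero])
  have eW : ∀ (p : MvPolynomial (Fin n) K) (w : W), p • w =
      (C (constantCoeff p) : MvPolynomial (Fin n) K) • w := fun p w => by
    rw [← sub_eq_zero, ← sub_smul, hW _ (sub_C_constantCoeff_mem p)]
  have eV : ∀ (p : MvPolynomial (Fin n) K) (v : V), p • v =
      (C (constantCoeff p) : MvPolynomial (Fin n) K) • v := fun p v => by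
    rw [← sub_eq_zero, ← sub_smul, hV _ (sub_C_constantCoeff_mem p)]
  let _ : Module K V := Module.compHom V (C : K →+* MvPolynomial (Fin n) K)
  let _ : Module K W := Module.compHom W (C : K →+* MvPolynomial (Fin n) K)
  let F : V →ₗ[K] W :=
    { toFun := f
      map_add' := map_add f
      map_smul' := fun c v => map_smul f (C c : MvPolynomial (Fin n) K) v }
  obtain ⟨G, hG⟩ := F.exists_leftInverse_of_injective (LinearMap.ker_eq_bot.2 hf)
  refine ⟨{ toFun := G, map_add' := map_add G, map_smul' := fun p w => ?_ }, ?_⟩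
  · rw [eW p, RingHom.id_apply, eV p]
    exact map_smul G (constantCoeff p) w
  · ext v
    exact LinearMap.congr_fun hG v

variable (n K M) in
/-- A module `M` all of whose modules `Tor_i(K, M)` embed into some `Tor_i(K, V)`, where `V`
is a quotient of `M` which is a vector space over the residue field. -/
def TorEmbedsInHead : Prop :=
  ∀ i, Function.Injective (torMap i
    ((irrelevantIdeal n K • (⊤ : Submodule (MvPolynomial (Fin n) K) M)).mkQ))

lemma smul_head_eq_zero (x : MvPolynomial (Fin n) K) (hx : x ∈ irrelevantIdeal n K)
    (v : M ⧸ (irrelevantIdeal n K • (⊤ : Submodule (MvPolynomial (Fin n) K) M))) : x • v = 0 := by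
  obtain ⟨m, rfl⟩ := Submodule.mkQ_surjective _ v
  rw [← map_smul, Submodule.mkQ_apply, Submodule.Quotient.mk_eq_zero]
  exact Submodule.smul_mem_smul hx trivial

lemma exists_factor_head (q : M →ₗ[MvPolynomial (Fin n) K] V)
    (hV : ∀ x ∈ irrelevantIdeal n K, ∀ v : V, x • v = 0) :
    ∃ q' : (M ⧸ (irrelevantIdeal n K • (⊤ : Submodule (MvPolynomial (Fin n) K) M))) →ₗ[
      MvPolynomial (Fin n) K] V,
      q' ∘ₗ (irrelevantIdeal n K • (⊤ : Submodule (MvPolynomial (Fin n) K) M)).mkQ = q := by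
  refine ⟨Submodule.liftQ _ q ?_, Submodule.liftQ_mkQ _ _ _⟩
  rw [Submodule.smul_le]
  intro x hx m _
  rw [LinearMap.mem_ker, map_smul, hV x hx]

lemma TorEmbedsInHead.of_injective (q : M →ₗ[MvPolynomial (Fin n) K] V)
    (hV : ∀ x ∈ irrelevantIdeal n K, ∀ v : V, x • v = 0)
    (hq : ∀ i, Function.Injective (torMap i q)) : TorEmbedsInHead n K M := by
  obtain ⟨q', rfl⟩ := exists_factor_head q hV
  intro i
  refine Function.Injective.of_comp (f := torMap i q') ?_
  intro a b hab
  apply hq i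
  rw [torMap_comp, torMap_comp]
  exact hab

/-- The inductive step for modules with linear quotients. -/
lemma TorEmbedsInHead.extension (f : M →ₗ[MvPolynomial (Fin n) K] N) (g : N →ₗ[MvPolynomial (Fin n) K] P)
    (hf : Function.Injective f)
    (h : Function.Exact f g) (hg : Function.Surjective g)
    (hM : TorEmbedsInHead n K M) (hP : TorEmbedsInHead n K P)
    (hfm : (irrelevantIdeal n K • (⊤ : Submodule (MvPolynomial (Fin n) K) N)).comap f ≤
      irrelevantIdeal n K • (⊤ : Submodule (MvPolynomial (Fin n) K) M)) :
    TorEmbedsInHead n K N ∧ ∀ i, dimK ((torResidue n K i).obj (ModuleCat.of (MvPolynomial (Fin n) K) N)) =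
      dimK ((torResidue n K i).obj (ModuleCat.of (MvPolynomial (Fin n) K) M)) +
        dimK ((torResidue n K i).obj (ModuleCat.of (MvPolynomial (Fin n) K) P)) := by
  let qM := (irrelevantIdeal n K • (⊤ : Submodule (MvPolynomial (Fin n) K) M)).mkQ
  let qN := (irrelevantIdeal n K • (⊤ : Submodule (MvPolynomial (Fin n) K) N)).mkQ
  obtain ⟨f', hf'⟩ := exists_factor_head (qN ∘ₗ f) smul_head_eq_zero
  have hf'i : Function.Injective f' := by
    refine (injective_iff_map_eq_zero f').2 fun v hv => ?_
    obtain ⟨m, rfl⟩ := Submodule.mkQ_surjective _ v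
    have : f' (qM m) = qN (f m) := LinearMap.congr_fun hf' m
    rw [this] at hv
    rw [Submodule.mkQ_apply, Submodule.Quotient.mk_eq_zero] at hv ⊢
    exact hfm hv
  obtain ⟨r, hr⟩ := exists_leftInverse_of_smul_eq_zero f' hf'i smul_head_eq_zero
  have hcomp : ∀ i, Function.Injective (torMap i (qN ∘ₗ f)) := fun i a b hab => by
    rw [← hf', torMap_comp, torMap_comp] at hab
    exact hM i (torMap_injective_of_leftInverse i f' r hr hab)
  have hTf : ∀ i, Function.Injective (torMap i f) := fun i a b hab =>
    hcomp i (by rw [torMap_comp, torMap_comp, hab])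
  obtain ⟨-, hex, -⟩ := torResidue_longExact (ModuleCat.ofHom f) (ModuleCat.ofHom g) hf h hg
  refine ⟨fun i => (injective_iff_map_eq_zero (torMap i qN).hom).2 fun z hz => ?_,
    dimK_torResidue_of_injective (ModuleCat.ofHom f) (ModuleCat.ofHom g) hf h hg hTf⟩
  let qP := (irrelevantIdeal n K • (⊤ : Submodule (MvPolynomial (Fin n) K) P)).mkQ
  obtain ⟨g', hg'⟩ := exists_factor_head (qP ∘ₗ g) smul_head_eq_zero
  have h1 : torMap i qP (torMap i g z) = 0 := by
    rw [← torMap_comp, ← hg', torMap_comp]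
    exact (congrArg _ hz).trans (map_zero (torMap i g').hom)
  have h2 : torMap i g z = 0 := hP i (h1.trans (map_zero (torMap i qP).hom).symm)
  obtain ⟨y, rfl⟩ := (hex i z).1 h2
  have h3 : y = 0 := hcomp i (by
    rw [torMap_comp]
    exact hz.trans (map_zero (torMap i (qN ∘ₗ f)).hom).symm)
  rw [h3, map_zero]

lemma torMap_smul_eq_zero {x : MvPolynomial (Fin n) K} (hx : x ∈ irrelevantIdeal n K) (i : ℕ) :
    torMap i (x • (LinearMap.id : M →ₗ[MvPolynomial (Fin n) K] M)) = 0 :=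
  torResidue_map_smul hx (ModuleCat.of (MvPolynomial (Fin n) K) M) i

variable (n K M) in
lemma subsingleton_torResidue [Subsingleton M] (i : ℕ) :
    Subsingleton ((torResidue n K i).obj (ModuleCat.of (MvPolynomial (Fin n) K) M)) := by
  have h := torMap_smul_eq_zero (M := M) (zero_mem (irrelevantIdeal n K)) i
  have e : (0 : MvPolynomial (Fin n) K) • (LinearMap.id : M →ₗ[MvPolynomial (Fin n) K] M) =
      LinearMap.id := by
    ext; exact Subsingleton.elim _ _
  rw [e, torMap, ModuleCat.ofHom_id, CategoryTheory.Functor.map_id] at h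
  refine ⟨fun a b => ?_⟩
  have ha : ∀ a : (torResidue n K i).obj (ModuleCat.of (MvPolynomial (Fin n) K) M), a = 0 := fun a =>
    congrArg (fun f : (torResidue n K i).obj (ModuleCat.of (MvPolynomial (Fin n) K) M) ⟶ _ => f a) h
  rw [ha a, ha b]

end Modules

variable (n K) in
/-- The ideal generated by a set of variables. -/
noncomputable abbrev varIdeal (A : Set (Fin n)) : Ideal (MvPolynomial (Fin n) K) :=
  Ideal.span ((X : Fin n → MvPolynomial (Fin n) K) '' A)

lemma mem_varIdeal_of_X_mul {A : Set (Fin n)} {k : Fin n} (hk : k ∉ A) {p : MvPolynomial (Fin n) K}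
    (hp : X k * p ∈ varIdeal n K A) : p ∈ varIdeal n K A := by
  rw [mem_ideal_span_X_image] at hp ⊢
  intro m hm
  obtain ⟨i, hi, him⟩ := hp (Finsupp.single k 1 + m) (by
    rw [mem_support_iff, coeff_X_mul]
    exact mem_support_iff.1 hm)
  refine ⟨i, hi, ?_⟩
  have : k ≠ i := fun h => hk (h ▸ hi)
  simpa [Finsupp.single_apply, this] using him

lemma varIdeal_insert (A : Set (Fin n)) (k : Fin n) :
    varIdeal n K (insert k A) = Ideal.span {X k} ⊔ varIdeal n K A := by
  rw [varIdeal, Set.image_insert_eq, Ideal.span_insert]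

lemma torResidue_varIdeal_insert {A : Set (Fin n)} {k : Fin n} (hk : k ∉ A) :
    (∀ i, Function.Injective (torMap i (Submodule.factor
      (Ideal.span_mono (Set.image_mono (Set.subset_insert k A)) :
        varIdeal n K A ≤ varIdeal n K (insert k A))))) ∧
    dimK ((torResidue n K 0).obj (ModuleCat.of (MvPolynomial (Fin n) K)
        (MvPolynomial (Fin n) K ⧸ varIdeal n K (insert k A)))) =
      dimK ((torResidue n K 0).obj (ModuleCat.of (MvPolynomial (Fin n) K)
        (MvPolynomial (Fin n) K ⧸ varIdeal n K A))) ∧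
    ∀ i, dimK ((torResidue n K (i + 1)).obj (ModuleCat.of (MvPolynomial (Fin n) K)
        (MvPolynomial (Fin n) K ⧸ varIdeal n K (insert k A)))) =
      dimK ((torResidue n K (i + 1)).obj (ModuleCat.of (MvPolynomial (Fin n) K)
        (MvPolynomial (Fin n) K ⧸ varIdeal n K A))) +
        dimK ((torResidue n K i).obj (ModuleCat.of (MvPolynomial (Fin n) K)
        (MvPolynomial (Fin n) K ⧸ varIdeal n K A))) := by
  have hle : varIdeal n K A ≤ varIdeal n K (insert k A) :=
    Ideal.span_mono (Set.image_mono (Set.subset_insert k A))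
  have hX : (X k : MvPolynomial (Fin n) K) ∈ irrelevantIdeal n K := Ideal.subset_span ⟨k, rfl⟩
  refine torResidue_of_eq_zero
    (ModuleCat.ofHom ((X k : MvPolynomial (Fin n) K) •
      (LinearMap.id : (MvPolynomial (Fin n) K ⧸ varIdeal n K A) →ₗ[MvPolynomial (Fin n) K] _)))
    (ModuleCat.ofHom (Submodule.factor hle)) ?_ ?_ (Submodule.factor_surjective hle)
    (torMap_smul_eq_zero hX)
  · refine (injective_iff_map_eq_zero ((X k : MvPolynomial (Fin n) K) •
      (LinearMap.id : (MvPolynomial (Fin n) K ⧸ varIdeal n K A) →ₗ[MvPolynomial (Fin n) K] _))).2 fun v hv => ?_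
    obtain ⟨p, rfl⟩ := Ideal.Quotient.mk_surjective v
    exact Ideal.Quotient.eq_zero_iff_mem.2
      (mem_varIdeal_of_X_mul hk (Ideal.Quotient.eq_zero_iff_mem.1 hv))
  · intro v
    obtain ⟨p, rfl⟩ := Ideal.Quotient.mk_surjective v
    have h1 : (Submodule.factor hle) (Ideal.Quotient.mk _ p) = 0 ↔
        p ∈ varIdeal n K (insert k A) := Ideal.Quotient.eq_zero_iff_mem
    refine h1.trans ?_
    rw [varIdeal_insert, Submodule.mem_sup]
    constructor
    · rintro ⟨a, ha, b, hb, rfl⟩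
      obtain ⟨c, rfl⟩ := Ideal.mem_span_singleton'.1 ha
      refine ⟨Ideal.Quotient.mk _ c, ?_⟩
      refine (Ideal.Quotient.eq (I := varIdeal n K A) (x := X k * c)).2 ?_
      have : X k * c - (c * X k + b) = -b := by ring
      rw [this]
      exact neg_mem hb
    · rintro ⟨c, hc⟩
      obtain ⟨c, rfl⟩ := Ideal.Quotient.mk_surjective c
      have h2 : X k * c - p ∈ varIdeal n K A := Ideal.Quotient.eq.1 hc
      exact ⟨c * X k, Ideal.mem_span_singleton'.2 ⟨c, rfl⟩, -(X k * c - p), neg_mem h2, by ring⟩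

lemma dimK_torResidue_varIdeal (A : Finset (Fin n)) (i : ℕ) :
    dimK ((torResidue n K i).obj (ModuleCat.of (MvPolynomial (Fin n) K)
        (MvPolynomial (Fin n) K ⧸ varIdeal n K (A : Set (Fin n))))) =
      (A.card.choose i : ℕ) := by
  classical
  induction A using Finset.induction_on generalizing i with
  | empty =>
    have : varIdeal n K ((∅ : Finset (Fin n)) : Set (Fin n)) = ⊥ := by simp
    rw [this, Finset.card_empty, ← dimK_torResidue_self (n := n) (K := K)]
    exact dimK_congr ((torResidue n K i).mapIso
      (Submodule.quotEquivOfEqBot (⊥ : Ideal (MvPolynomial (Fin n) K)) rfl).toModuleIso)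
  | insert k A hk ih =>
    rw [Finset.coe_insert, Finset.card_insert_of_notMem hk]
    obtain ⟨-, h0, h1⟩ := torResidue_varIdeal_insert (K := K) (A := (A : Set (Fin n))) (k := k)
      (by simpa using hk)
    cases i with
    | zero => rw [h0, ih]; simp
    | succ i => rw [h1, ih, ih, Nat.choose_succ_succ, add_comm, Nat.cast_add]

lemma torEmbedsInHead_varIdeal (A : Finset (Fin n)) :
    TorEmbedsInHead n K (MvPolynomial (Fin n) K ⧸ varIdeal n K (A : Set (Fin n))) := by
  classical
  have key : ∀ B : Finset (Fin n), ∃ q : (MvPolynomial (Fin n) K ⧸ varIdeal n K (A : Set (Fin n))) →ₗ[MvPolynomial (Fin n) K]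
      (MvPolynomial (Fin n) K ⧸ varIdeal n K ((A ∪ B : Finset (Fin n)) : Set (Fin n))),
      ∀ i, Function.Injective (torMap i q) := by
    intro B
    induction B using Finset.induction_on with
    | empty =>
      rw [Finset.union_empty]
      exact ⟨LinearMap.id, fun i => torMap_injective_of_leftInverse i _ LinearMap.id rfl⟩
    | insert k B _ ih =>
      obtain ⟨q, hq⟩ := ih
      rw [Finset.union_insert]
      by_cases hk : k ∈ A ∪ B
      · rw [Finset.insert_eq_of_mem hk]
        exact ⟨q, hq⟩
      · rw [Finset.coe_insert]
        obtain ⟨h, -⟩ := torResidue_varIdeal_insert (K := K)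
          (A := ((A ∪ B : Finset (Fin n)) : Set (Fin n))) (k := k) (by simpa using hk)
        refine ⟨Submodule.factor (Ideal.span_mono (Set.image_mono (Set.subset_insert k _))) ∘ₗ q,
          fun i a b hab => hq i (h i ?_)⟩
        rwa [torMap_comp, torMap_comp] at hab
  obtain ⟨q, hq⟩ := key Finset.univ
  refine TorEmbedsInHead.of_injective q (fun x hx v => ?_) hq
  obtain ⟨p, rfl⟩ := Ideal.Quotient.mk_surjective v
  refine Ideal.Quotient.eq_zero_iff_mem.2 (Ideal.mul_mem_right p _ ?_)
  simpa [varIdeal, irrelevantIdeal] using hx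

lemma mem_smul_top_ideal (I : Ideal (MvPolynomial (Fin n) K)) (x : I) :
    x ∈ irrelevantIdeal n K • (⊤ : Submodule (MvPolynomial (Fin n) K) I) ↔
      (x : MvPolynomial (Fin n) K) ∈ irrelevantIdeal n K * I := by
  have : (irrelevantIdeal n K • (⊤ : Submodule (MvPolynomial (Fin n) K) I)).map I.subtype =
      irrelevantIdeal n K * I := by
    rw [Submodule.map_smul'', Submodule.map_top, Submodule.range_subtype, smul_eq_mul]
  rw [← this]
  refine ⟨fun h => ⟨x, h, rfl⟩, ?_⟩
  rintro ⟨y, hy, hyx⟩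
  rwa [← Subtype.ext hyx]

/-- The quotient `(J + (p)) / J` is `S / (J : p)`. -/
lemma exists_surjective_exact_of_colon {R : Type u} [CommRing R] {J L : Ideal R} {p : R}
    (hcolon : ∀ f : R, f * p ∈ J ↔ f ∈ L) :
    ∃ g : (J ⊔ Ideal.span {p} : Ideal R) →ₗ[R] R ⧸ L, Function.Surjective g ∧
      Function.Exact (Submodule.inclusion (le_sup_left : J ≤ J ⊔ Ideal.span {p})) g := by
  have hp : p ∈ J ⊔ Ideal.span {p} := Ideal.mem_sup_right (Ideal.mem_span_singleton_self p)
  let f := Submodule.inclusion (le_sup_left : J ≤ J ⊔ Ideal.span {p})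
  have hmemf : ∀ x : (J ⊔ Ideal.span {p} : Ideal R), x ∈ LinearMap.range f ↔ (x : R) ∈ J :=
    fun x => by rw [Submodule.range_inclusion, Submodule.mem_comap]; rfl
  let φ := (LinearMap.range f).mkQ ∘ₗ
    LinearMap.toSpanSingleton R (J ⊔ Ideal.span {p} : Ideal R) ⟨p, hp⟩
  have hφ : Function.Surjective φ := by
    intro v
    obtain ⟨⟨x, hx⟩, rfl⟩ := Submodule.mkQ_surjective _ v
    obtain ⟨a, ha, b, hb, rfl⟩ := Submodule.mem_sup.1 hx
    obtain ⟨c, rfl⟩ := Ideal.mem_span_singleton'.1 hb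
    refine ⟨c, (Submodule.Quotient.eq _).2 ((hmemf _).2 ?_)⟩
    change c * p - (a + c * p) ∈ J
    have : c * p - (a + c * p) = -a := by ring
    rw [this]
    exact neg_mem ha
  have hker : LinearMap.ker φ = L := by
    ext c
    rw [LinearMap.mem_ker, ← hcolon]
    exact (Submodule.Quotient.mk_eq_zero _).trans (hmemf _)
  let e := (Submodule.quotEquivOfEq _ _ hker.symm).trans (φ.quotKerEquivOfSurjective hφ)
  refine ⟨e.symm.toLinearMap ∘ₗ (LinearMap.range f).mkQ,
    e.symm.surjective.comp (Submodule.mkQ_surjective _), fun x => ?_⟩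
  refine (map_eq_zero_iff e.symm e.symm.injective).trans ?_
  exact (Submodule.Quotient.mk_eq_zero _).trans LinearMap.mem_range

lemma mem_mul_of_mem_mul_sup {R : Type u} [CommRing R] {m J L : Ideal R} {p : R}
    (hcolon : ∀ f : R, f * p ∈ J ↔ f ∈ L) (hlin : ∀ c ∈ L, c * p ∈ m * J) {x : R} (hx : x ∈ J)
    (h : x ∈ m * (J ⊔ Ideal.span {p})) : x ∈ m * J := by
  rw [Ideal.mul_sup, Submodule.mem_sup] at h
  obtain ⟨a, ha, b, hb, h⟩ := h
  obtain ⟨c, hc, rfl⟩ := Ideal.mem_mul_span_singleton.1 hb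
  have haJ : a ∈ J := (Ideal.mul_le_right : m * J ≤ J) ha
  rw [← h] at hx ⊢
  have : c * p ∈ J := (J.add_mem_iff_right haJ).1 hx
  exact add_mem ha (hlin c ((hcolon c).1 this))

lemma comap_smul_top_le_of_colon {J L : Ideal (MvPolynomial (Fin n) K)}
    {p : MvPolynomial (Fin n) K}
    (hcolon : ∀ f : MvPolynomial (Fin n) K, f * p ∈ J ↔ f ∈ L)
    (hlin : ∀ c ∈ L, c * p ∈ irrelevantIdeal n K * J) :
    (irrelevantIdeal n K • (⊤ : Submodule (MvPolynomial (Fin n) K)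
      (J ⊔ Ideal.span {p} : Ideal (MvPolynomial (Fin n) K)))).comap
        (Submodule.inclusion (le_sup_left : J ≤ J ⊔ Ideal.span {p})) ≤
      irrelevantIdeal n K • (⊤ : Submodule (MvPolynomial (Fin n) K) J) :=
  fun x h => (mem_smul_top_ideal J x).2 (mem_mul_of_mem_mul_sup hcolon hlin x.2
    ((mem_smul_top_ideal _ _).1 h))

/-- Adding a generator whose colon ideal is generated by variables. -/
lemma TorEmbedsInHead.ideal_sup {J : Ideal (MvPolynomial (Fin n) K)}
    {p : MvPolynomial (Fin n) K} {A : Finset (Fin n)} (hJ : TorEmbedsInHead n K J)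
    (hcolon : ∀ f : MvPolynomial (Fin n) K,
      f * p ∈ J ↔ f ∈ varIdeal n K (A : Set (Fin n)))
    (hlin : ∀ k ∈ A, X k * p ∈ irrelevantIdeal n K * J) :
    TorEmbedsInHead n K (J ⊔ Ideal.span {p} : Ideal (MvPolynomial (Fin n) K)) ∧
      ∀ i, bettiNumber (J ⊔ Ideal.span {p}) i = bettiNumber J i + (A.card.choose i : ℕ) := by
  have hlin' : ∀ c ∈ varIdeal n K (A : Set (Fin n)), c * p ∈ irrelevantIdeal n K * J := by
    intro c hc
    induction hc using Submodule.span_induction with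
    | mem x hx => obtain ⟨k, hk, rfl⟩ := hx; exact hlin k hk
    | zero => rw [zero_mul]; exact zero_mem _
    | add x y _ _ hx hy => rw [add_mul]; exact add_mem hx hy
    | smul a x _ hx => rw [smul_eq_mul, mul_assoc]; exact Ideal.mul_mem_left _ _ hx
  obtain ⟨g, hg, hex⟩ := exists_surjective_exact_of_colon hcolon
  obtain ⟨h1, h2⟩ := TorEmbedsInHead.extension _ g (Submodule.inclusion_injective _) hex hg hJ
    (torEmbedsInHead_varIdeal A) (comap_smul_top_le_of_colon hcolon hlin')
  exact ⟨h1, fun i => (h2 i).trans (congrArg _ (dimK_torResidue_varIdeal A i))⟩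

/-- The Betti numbers of an ideal with linear quotients. -/
theorem bettiNumber_span_of_linearQuotients (m : ℕ) (p : ℕ → MvPolynomial (Fin n) K)
    (A : ℕ → Finset (Fin n))
    (hcolon : ∀ a < m, ∀ f : MvPolynomial (Fin n) K, f * p a ∈ Ideal.span (p '' Set.Iio a) ↔
      f ∈ varIdeal n K (A a : Set (Fin n)))
    (hlin : ∀ a < m, ∀ k ∈ A a,
      X k * p a ∈ irrelevantIdeal n K * Ideal.span (p '' Set.Iio a)) (i : ℕ) :
    bettiNumber (Ideal.span (p '' Set.Iio m)) i =
      ((∑ a ∈ Finset.range m, (A a).card.choose i : ℕ) : Cardinal.{u}) := by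
  suffices h : TorEmbedsInHead n K (Ideal.span (p '' Set.Iio m)) ∧
      ∀ i, bettiNumber (Ideal.span (p '' Set.Iio m)) i =
        ((∑ a ∈ Finset.range m, (A a).card.choose i : ℕ) : Cardinal.{u}) from h.2 i
  induction m with
  | zero =>
    have : Subsingleton (Ideal.span (p '' Set.Iio 0)) := by
      have : Ideal.span (p '' Set.Iio 0) = ⊥ := by simp
      rw [this]
      infer_instance
    refine ⟨fun i a b _ => (subsingleton_torResidue n K _ i).elim a b, fun i => ?_⟩
    have := subsingleton_torResidue n K (Ideal.span (p '' Set.Iio 0)) i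
    rw [Finset.sum_range_zero, Nat.cast_zero]
    exact @rank_subsingleton' K _ _ _ _ _ this
  | succ m ih =>
    obtain ⟨h1, h2⟩ := ih (fun a ha => hcolon a (ha.trans (Nat.lt_succ_self m)))
      (fun a ha => hlin a (ha.trans (Nat.lt_succ_self m)))
    have e : Ideal.span (p '' Set.Iio (m + 1)) =
        Ideal.span (p '' Set.Iio m) ⊔ Ideal.span {p m} := by
      rw [← Ideal.span_union, ← Set.image_singleton, ← Set.image_union]
      congr 2
      ext x
      simp
    obtain ⟨h3, h4⟩ := h1.ideal_sup (hcolon m (Nat.lt_succ_self m)) (hlin m (Nat.lt_succ_self m))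
    rw [e]
    refine ⟨h3, fun i => ?_⟩
    rw [h4, h2, Finset.sum_range_succ, Nat.cast_add]

end LinearQuotients
end EdgeIdeal

namespace EdgeIdeal

section Combinatorics

variable {n : ℕ}

lemma eq_of_le_of_degree_eq {a b : Fin n →₀ ℕ} (h : a ≤ b) (hd : a.degree = b.degree) :
    a = b := by
  obtain ⟨c, rfl⟩ := exists_add_of_le h
  rw [map_add] at hd
  have : c.degree = 0 := by omega
  rw [(Finsupp.degree_eq_zero_iff c).1 this, add_zero]

lemma exists_eq_single_of_degree_eq_one {c : Fin n →₀ ℕ} (h : c.degree = 1) :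
    ∃ x, c = Finsupp.single x 1 := by
  have hc : c ≠ 0 := by rintro rfl; simp at h
  obtain ⟨x, hx⟩ := Finsupp.ne_iff.1 hc
  refine ⟨x, (eq_of_le_of_degree_eq ?_ ?_).symm⟩
  · rw [Finsupp.single_le_iff]
    exact Nat.one_le_iff_ne_zero.2 hx
  · rw [h, Finsupp.degree_single]

lemma IsSqfreeDegTwo.exists_eq {e : Fin n →₀ ℕ} (he : IsSqfreeDegTwo e) {i : Fin n}
    (hi : e i ≠ 0) : ∃ x, x ≠ i ∧ e = Finsupp.single i 1 + Finsupp.single x 1 := by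
  have hle : Finsupp.single i 1 ≤ e := by
    rw [Finsupp.single_le_iff]; exact Nat.one_le_iff_ne_zero.2 hi
  obtain ⟨c, rfl⟩ := exists_add_of_le hle
  have hd := he.2
  rw [map_add, Finsupp.degree_single] at hd
  obtain ⟨x, rfl⟩ := exists_eq_single_of_degree_eq_one (c := c) (by omega)
  refine ⟨x, ?_, rfl⟩
  rintro rfl
  have := he.1 x
  simp at this

lemma isSqfreeDegTwo_single_add_single {a b : Fin n} (hab : a ≠ b) :
    IsSqfreeDegTwo (Finsupp.single a 1 + Finsupp.single b 1) := by
  refine ⟨fun i => ?_, by simp⟩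
  simp only [Finsupp.add_apply, Finsupp.single_apply]
  split_ifs <;> omega

/-- All later pairs of variables lie in a final lexsegment set as soon as an earlier variable
divides one of its members. -/
lemma finalLexsegment_exchange {v e : Fin n →₀ ℕ} (he : e ∈ finalLexsegment v) {i a b : Fin n}
    (hi : e i ≠ 0) (ha : i < a) (hb : i < b) (hab : a ≠ b) :
    Finsupp.single a 1 + Finsupp.single b 1 ∈ finalLexsegment v := by
  refine ⟨isSqfreeDegTwo_single_add_single hab, le_trans (le_of_lt ?_) he.2⟩
  have hne : e.support.Nonempty := ⟨i, Finsupp.mem_support_iff.2 hi⟩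
  let y := e.support.min' hne
  have hyi : y ≤ i := Finset.min'_le _ _ (Finsupp.mem_support_iff.2 hi)
  have hz : ∀ j ≤ y, (Finsupp.single a 1 + Finsupp.single b 1 : Fin n →₀ ℕ) j = 0 := by
    intro j hj
    have h1 : a ≠ j := ((hj.trans hyi).trans_lt ha).ne'
    have h2 : b ≠ j := ((hj.trans hyi).trans_lt hb).ne'
    simp [h1, h2]
  refine Finsupp.Lex.lt_iff.2 ⟨y, fun j hj => ?_, ?_⟩
  · change (Finsupp.single a 1 + Finsupp.single b 1 : Fin n →₀ ℕ) j = e j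
    rw [hz j hj.le]
    by_contra h
    exact absurd (Finset.min'_le e.support j (Finsupp.mem_support_iff.2 (Ne.symm h)))
      (not_le.2 hj)
  · change (Finsupp.single a 1 + Finsupp.single b 1 : Fin n →₀ ℕ) y < e y
    rw [hz y le_rfl]
    exact Nat.pos_of_ne_zero (Finsupp.mem_support_iff.1 (Finset.min'_mem _ hne))

/-- The products of `t` monomials from a given set. -/
def powGens (E : Set (Fin n →₀ ℕ)) (t : ℕ) : Set (Fin n →₀ ℕ) :=
  {w | ∃ s : Multiset (Fin n →₀ ℕ), (∀ e ∈ s, e ∈ E) ∧ s.card = t ∧ s.sum = w}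

lemma powGens_zero (E : Set (Fin n →₀ ℕ)) : powGens E 0 = {0} := by
  ext w
  constructor
  · rintro ⟨s, -, hs, rfl⟩
    rw [Multiset.card_eq_zero.1 hs]
    simp
  · rintro rfl
    exact ⟨0, by simp, by simp, by simp⟩

open scoped Pointwise in
lemma powGens_succ (E : Set (Fin n →₀ ℕ)) (t : ℕ) : powGens E (t + 1) = powGens E t + E := by
  ext w
  rw [Set.mem_add]
  constructor
  · rintro ⟨s, h, hs, rfl⟩
    obtain ⟨e, he⟩ := Multiset.card_pos_iff_exists_mem.1 (hs.symm ▸ Nat.succ_pos t : 0 < s.card)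
    obtain ⟨r, rfl⟩ := Multiset.exists_cons_of_mem he
    refine ⟨r.sum, ⟨r, fun e he => h e (Multiset.mem_cons_of_mem he), ?_, rfl⟩, e,
      h e (Multiset.mem_cons_self e r), ?_⟩
    · simpa using hs
    · rw [Multiset.sum_cons, add_comm]
  · rintro ⟨x, ⟨r, h, hr, rfl⟩, e, he, rfl⟩
    refine ⟨e ::ₘ r, ?_, by simp [hr], by rw [Multiset.sum_cons, add_comm]⟩
    intro e' he'
    rcases Multiset.mem_cons.1 he' with rfl | h'
    exacts [he, h _ h']

lemma degree_of_mem_powGens {E : Set (Fin n →₀ ℕ)} (hE : ∀ e ∈ E, IsSqfreeDegTwo e) {t : ℕ}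
    {w : Fin n →₀ ℕ} (hw : w ∈ powGens E t) : w.degree = 2 * t := by
  obtain ⟨s, h, rfl, rfl⟩ := hw
  induction s using Multiset.induction_on with
  | empty => simp
  | cons e s ih =>
    rw [Multiset.sum_cons, map_add, (hE e (h e (Multiset.mem_cons_self e s))).2,
      ih fun e he => h e (Multiset.mem_cons_of_mem he), Multiset.card_cons]
    ring

lemma apply_le_of_mem_powGens {E : Set (Fin n →₀ ℕ)} (hE : ∀ e ∈ E, IsSqfreeDegTwo e) {t : ℕ}
    {w : Fin n →₀ ℕ} (hw : w ∈ powGens E t) (k : Fin n) : w k ≤ t := by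
  obtain ⟨s, h, rfl, rfl⟩ := hw
  induction s using Multiset.induction_on with
  | empty => simp
  | cons e s ih =>
    rw [Multiset.sum_cons, Finsupp.add_apply, Multiset.card_cons]
    have h1 := (hE e (h e (Multiset.mem_cons_self e s))).1 k
    have h2 := ih fun e he => h e (Multiset.mem_cons_of_mem he)
    omega

lemma exists_mem_apply_ne_zero {s : Multiset (Fin n →₀ ℕ)} {k : Fin n} (h : s.sum k ≠ 0) :
    ∃ e ∈ s, e k ≠ 0 := by
  by_contra! hc
  apply h
  induction s using Multiset.induction_on with
  | empty => simp
  | cons e s ih =>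
    rw [Multiset.sum_cons, Finsupp.add_apply, hc e (Multiset.mem_cons_self e s), zero_add]
    by_contra h0
    exact h0 (ih h0 fun e he => hc e (Multiset.mem_cons_of_mem he))

lemma exists_mem_apply_eq_zero {s : Multiset (Fin n →₀ ℕ)} {k : Fin n} (h : s.sum k < s.card) :
    ∃ e ∈ s, e k = 0 := by
  by_contra! hc
  refine absurd h (not_lt.2 ?_)
  clear h
  induction s using Multiset.induction_on with
  | empty => simp
  | cons e s ih =>
    rw [Multiset.sum_cons, Finsupp.add_apply, Multiset.card_cons]
    have h1 := hc e (Multiset.mem_cons_self e s)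
    have h2 := ih fun e he => hc e (Multiset.mem_cons_of_mem he)
    omega

lemma powGens_exchange {v : Fin n →₀ ℕ} {t : ℕ} {w : Fin n →₀ ℕ}
    (hw : w ∈ powGens (finalLexsegment v) t) {i k : Fin n} (hi : w i ≠ 0)
    (hmin : ∀ j < i, w j = 0) (hik : i < k) (hk : w k < t) :
    ∃ w' ∈ powGens (finalLexsegment v) t,
      w' + Finsupp.single i 1 = w + Finsupp.single k 1 := by
  classical
  obtain ⟨s, h, rfl, rfl⟩ := hw
  have hmin' : ∀ e ∈ s, ∀ j, e j ≠ 0 → i ≤ j := by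
    intro e he j hj
    by_contra hc
    have := hmin j (not_le.1 hc)
    obtain ⟨r, rfl⟩ := Multiset.exists_cons_of_mem he
    rw [Multiset.sum_cons, Finsupp.add_apply] at this
    omega
  by_cases hA : ∃ e ∈ s, e i ≠ 0 ∧ e k = 0
  · obtain ⟨e, he, hei, hek⟩ := hA
    obtain ⟨x, hx, hex⟩ := (h e he).1.exists_eq hei
    have hxe : e x ≠ 0 := by rw [hex]; simp
    have hix : i < x := lt_of_le_of_ne (hmin' e he x hxe) hx.symm
    have hxk : k ≠ x := by rintro rfl; exact hxe hek
    obtain ⟨r, rfl⟩ := Multiset.exists_cons_of_mem he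
    refine ⟨_, ⟨(Finsupp.single k 1 + Finsupp.single x 1) ::ₘ r, ?_, by simp, rfl⟩, ?_⟩
    · intro e' he'
      rcases Multiset.mem_cons.1 he' with rfl | h'
      · exact finalLexsegment_exchange (h e he) hei hik hix hxk
      · exact h _ (Multiset.mem_cons_of_mem h')
    · rw [Multiset.sum_cons, Multiset.sum_cons, hex]
      abel
  · push Not at hA
    obtain ⟨e, he, hei⟩ := exists_mem_apply_ne_zero hi
    obtain ⟨g, hg, hgk⟩ := exists_mem_apply_eq_zero hk
    have hgi : g i = 0 := by
      by_contra hc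
      exact hA g hg hc hgk
    obtain ⟨x, hx, hex⟩ := (h e he).1.exists_eq hei
    have hxk : x = k := by
      by_contra hc
      apply hA e he hei
      rw [hex]
      simp [hc, hik.ne]
    subst hxk
    have hg0 : g ≠ 0 := by
      rintro rfl
      have := (h _ hg).1.2
      simp at this
    obtain ⟨b, hb⟩ := Finsupp.ne_iff.1 hg0
    obtain ⟨c, hcb, hgc⟩ := (h g hg).1.exists_eq hb
    have hc : g c ≠ 0 := by rw [hgc]; simp
    have hib : i < b := lt_of_le_of_ne (hmin' g hg b hb) (by rintro rfl; exact hb hgi)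
    have hic : i < c := lt_of_le_of_ne (hmin' g hg c hc) (by rintro rfl; exact hc hgi)
    have hxb : x ≠ b := by rintro rfl; exact hb hgk
    have hxc : x ≠ c := by rintro rfl; exact hc hgk
    obtain ⟨r, rfl⟩ := Multiset.exists_cons_of_mem he
    have hgr : g ∈ r := by
      rcases Multiset.mem_cons.1 hg with rfl | h'
      · exact absurd hgi hei
      · exact h'
    obtain ⟨r, rfl⟩ := Multiset.exists_cons_of_mem hgr
    refine ⟨_, ⟨(Finsupp.single x 1 + Finsupp.single b 1) ::ₘ
      (Finsupp.single x 1 + Finsupp.single c 1) ::ₘ r, ?_, by simp, rfl⟩, ?_⟩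
    · intro e' he'
      rcases Multiset.mem_cons.1 he' with rfl | h'
      · exact finalLexsegment_exchange (h e he) hei hik hib hxb
      · rcases Multiset.mem_cons.1 h' with rfl | h'
        · exact finalLexsegment_exchange (h e he) hei hik hic hxc
        · exact h _ (Multiset.mem_cons_of_mem (Multiset.mem_cons_of_mem h'))
    · simp only [Multiset.sum_cons]
      rw [hex, hgc]
      abel

lemma exists_minVar_eq {w : Fin n →₀ ℕ} (hw : w ≠ 0) :
    ∃ i : Fin n, w i ≠ 0 ∧ (∀ j < i, w j = 0) ∧ minVar w = i + 1 := by
  obtain ⟨x, hx⟩ := Finsupp.ne_iff.1 hw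
  have hne : {j | ∃ i : Fin n, w i ≠ 0 ∧ j = (i : ℕ) + 1}.Nonempty := ⟨_, x, hx, rfl⟩
  obtain ⟨i, hi, hj⟩ := Nat.sInf_mem hne
  refine ⟨i, hi, fun j hji => ?_, hj⟩
  by_contra hc
  have : minVar w ≤ (j : ℕ) + 1 := Nat.sInf_le ⟨j, hc, rfl⟩
  have h2 : minVar w = i + 1 := hj
  have : (j : ℕ) < i := hji
  omega

lemma RevlexLT.asymm {a b : Fin n →₀ ℕ} (h : RevlexLT a b) : ¬ RevlexLT b a := by
  rintro (h' | ⟨h', l', hl', hlt'⟩)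
  · rcases h with h | ⟨h, -⟩ <;> omega
  · rcases h with h | ⟨-, l, hl, hlt⟩
    · omega
    · rcases lt_trichotomy l l' with h | rfl | h
      · have := hl _ h; omega
      · omega
      · have := hl' _ h; omega

/-- The indices of the later variables which do not occur with exponent `t`. -/
noncomputable def laterNonfull (t : ℕ) (w : Fin n →₀ ℕ) : Finset (Fin n) :=
  {k | minVar w < (k : ℕ) + 1 ∧ w k < t}

lemma mem_laterNonfull {t : ℕ} {w : Fin n →₀ ℕ} {k : Fin n} :
    k ∈ laterNonfull t w ↔ minVar w < (k : ℕ) + 1 ∧ w k < t := by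
  simp [laterNonfull]

lemma apply_add_apply_add_apply_le_degree (w : Fin n →₀ ℕ) {a b c : Fin n} (hab : a ≠ b)
    (hac : a ≠ c) (hbc : b ≠ c) : w a + w b + w c ≤ w.degree := by
  have : Finsupp.single a (w a) + Finsupp.single b (w b) + Finsupp.single c (w c) ≤ w := by
    intro j
    simp only [Finsupp.add_apply, Finsupp.single_apply]
    split_ifs <;> simp_all
  simpa using Finsupp.degree_mono this

open scoped Classical in
lemma card_laterNonfull {t : ℕ} (ht : 1 ≤ t) {w : Fin n →₀ ℕ} (hd : w.degree = 2 * t)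
    (hle : ∀ k, w k ≤ t) :
    minVar w + (laterNonfull t w).card + (if HasLaterPower t w then 1 else 0) = n := by
  have hw : w ≠ 0 := by rintro rfl; simp at hd; omega
  obtain ⟨i, hi, -, hmin⟩ := exists_minVar_eq hw
  have hcard : (laterNonfull t w).card + ((Finset.Ioi i).filter fun k => ¬ w k < t).card =
      n - 1 - i := by
    rw [← Fin.card_Ioi,
      ← Finset.card_filter_add_card_filter_not (s := Finset.Ioi i) (fun k => w k < t)]
    congr 2
    refine Finset.ext fun k => ?_
    rw [mem_laterNonfull, Finset.mem_filter, Finset.mem_Ioi, hmin, Fin.lt_def]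
    omega
  have hfull : ((Finset.Ioi i).filter fun k => ¬ w k < t).card =
      if HasLaterPower t w then 1 else 0 := by
    split_ifs with h
    · obtain ⟨k, hk, hkt⟩ := h
      rw [Finsupp.single_le_iff] at hkt
      rw [Finset.card_eq_one]
      refine ⟨k, ?_⟩
      ext j
      rw [Finset.mem_filter, Finset.mem_Ioi, Finset.mem_singleton]
      have hik : i < k := by rw [Fin.lt_def]; omega
      constructor
      · rintro ⟨hj, hjt⟩
        by_contra hjk
        have := apply_add_apply_add_apply_le_degree w hj.ne hik.ne hjk
        omega
      · rintro rfl
        exact ⟨hik, by omega⟩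
    · rw [Finset.card_eq_zero, Finset.filter_eq_empty_iff]
      intro k hk hkt
      rw [Finset.mem_Ioi, Fin.lt_def] at hk
      refine h ⟨k, by omega, ?_⟩
      rw [Finsupp.single_le_iff]
      omega
  rw [← hfull]
  have := i.2
  omega

end Combinatorics

section Ideals

variable {n : ℕ} {K : Type u} [Field K]

open scoped Pointwise in
lemma span_pow_eq_span_powGens (E : Set (Fin n →₀ ℕ)) (t : ℕ) :
    (Ideal.span ((fun w => monomial w (1 : K)) '' E)) ^ t =
      Ideal.span ((fun w => monomial w (1 : K)) '' powGens E t) := by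
  induction t with
  | zero => simp [powGens_zero, Ideal.one_eq_top]
  | succ t ih =>
    rw [pow_succ, ih, Ideal.span_mul_span', powGens_succ]
    congr 1
    ext f
    simp only [Set.mem_mul, Set.mem_image, Set.mem_add]
    constructor
    · rintro ⟨_, ⟨a, ha, rfl⟩, _, ⟨b, hb, rfl⟩, rfl⟩
      exact ⟨a + b, ⟨a, ha, b, hb, rfl⟩, by rw [monomial_mul, one_mul]⟩
    · rintro ⟨_, ⟨a, ha, b, hb, rfl⟩, rfl⟩
      exact ⟨_, ⟨a, ha, rfl⟩, _, ⟨b, hb, rfl⟩, by rw [monomial_mul, one_mul]⟩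

lemma monomial_mem_span_iff (A : Set (Fin n →₀ ℕ)) (w : Fin n →₀ ℕ) :
    monomial w (1 : K) ∈ Ideal.span ((fun w => monomial w (1 : K)) '' A) ↔ ∃ a ∈ A, a ≤ w := by
  rw [mem_ideal_span_monomial_image]
  simp

lemma mul_monomial_mem_span_iff (A : Set (Fin n →₀ ℕ)) (w : Fin n →₀ ℕ)
    (f : MvPolynomial (Fin n) K) :
    f * monomial w (1 : K) ∈ Ideal.span ((fun w => monomial w (1 : K)) '' A) ↔
      ∀ m ∈ f.support, ∃ a ∈ A, a ≤ m + w := by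
  rw [mem_ideal_span_monomial_image]
  constructor
  · intro h m hm
    refine h (m + w) ?_
    rw [mem_support_iff, coeff_mul_monomial, mul_one]
    exact mem_support_iff.1 hm
  · intro h m hm
    rw [mem_support_iff, coeff_mul_monomial'] at hm
    split_ifs at hm with hw
    · rw [mul_one] at hm
      obtain ⟨a, ha, h⟩ := h (m - w) (mem_support_iff.2 hm)
      exact ⟨a, ha, by rwa [tsub_add_cancel_of_le hw] at h⟩
    · exact absurd rfl hm

lemma minGens_span_eq {A : Set (Fin n →₀ ℕ)} {d : ℕ} (hA : ∀ a ∈ A, a.degree = d) :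
    minGens (Ideal.span ((fun w => monomial w (1 : K)) '' A)) = A := by
  ext w
  simp only [minGens, monomial_mem_span_iff, Set.mem_ofPred_eq]
  constructor
  · rintro ⟨⟨a, ha, haw⟩, hmin⟩
    rwa [← le_antisymm haw (hmin ⟨a, ha, le_rfl⟩ haw)]
  · intro hw
    refine ⟨⟨w, hw, le_rfl⟩, ?_⟩
    rintro y ⟨a, ha, hay⟩ hyw
    rwa [← eq_of_le_of_degree_eq (hay.trans hyw) ((hA a ha).trans (hA w hw).symm)]

lemma mem_colonIdeal_iff {m : ℕ} (w : Fin m → Fin n →₀ ℕ) (a : Fin m)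
    (f : MvPolynomial (Fin n) K) :
    f ∈ colonIdeal K w a ↔ ∀ c ∈ f.support, ∃ b < a, w b ≤ c + w a := by
  have e : {f | ∃ b : Fin m, b < a ∧ f = monomial (w b) (1 : K)} =
      (fun w => monomial w (1 : K)) '' (w '' Set.Iio a) := by
    ext f
    simp [eq_comm]
  have h2 := mul_monomial_mem_span_iff (w '' Set.Iio a) (w a) f
  rw [← e] at h2
  have h3 : f ∈ colonIdeal K w a ↔ f * monomial (w a) (1 : K) ∈
      Ideal.span {f | ∃ b : Fin m, b < a ∧ f = monomial (w b) (1 : K)} := by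
    rw [colonIdeal, Ideal.mem_colon_span_singleton]
  rw [h3, h2]
  simp

/-- Enumerations of the products of `t` elements of a final lexsegment set in increasing
reverse lexicographic order. -/
def IsRevlexEnumerationOfPow (v : Fin n →₀ ℕ) (t : ℕ) {m : ℕ} (w : Fin m → Fin n →₀ ℕ) : Prop :=
  (∀ a b : Fin m, a < b → RevlexLT (w a) (w b)) ∧
    Set.range w = powGens (finalLexsegment v) t

namespace IsRevlexEnumerationOfPow

variable {v : Fin n →₀ ℕ} {t m : ℕ} {w : Fin m → Fin n →₀ ℕ}

lemma mem (h : IsRevlexEnumerationOfPow v t w) (a : Fin m) :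
    w a ∈ powGens (finalLexsegment v) t :=
  h.2 ▸ Set.mem_range_self a

lemma degree (h : IsRevlexEnumerationOfPow v t w) (a : Fin m) : (w a).degree = 2 * t :=
  degree_of_mem_powGens (fun _ he => he.1) (h.mem a)

lemma apply_le (h : IsRevlexEnumerationOfPow v t w) (a : Fin m) (k : Fin n) : w a k ≤ t :=
  apply_le_of_mem_powGens (fun _ he => he.1) (h.mem a) k

lemma ne_zero (h : IsRevlexEnumerationOfPow v t w) (ht : 1 ≤ t) (a : Fin m) : w a ≠ 0 := by
  intro h0
  have := h.degree a
  rw [h0, map_zero] at this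
  omega

lemma exists_lt_of_mem_laterNonfull (h : IsRevlexEnumerationOfPow v t w) (ht : 1 ≤ t)
    {a : Fin m} {k : Fin n} (hk : k ∈ laterNonfull t (w a)) :
    ∃ b < a, ∃ l, w b + Finsupp.single l 1 = w a + Finsupp.single k 1 := by
  obtain ⟨i, hi, hi0, hmin⟩ := exists_minVar_eq (h.ne_zero ht a)
  rw [mem_laterNonfull, hmin] at hk
  have hik : i < k := by rw [Fin.lt_def]; omega
  obtain ⟨w', hw', e⟩ := powGens_exchange (h.mem a) hi hi0 hik hk.2
  rw [← h.2] at hw'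
  obtain ⟨b, rfl⟩ := hw'
  refine ⟨b, ?_, i, e⟩
  have hlt : RevlexLT (w b) (w a) := by
    refine Or.inr ⟨(h.degree b).trans (h.degree a).symm, k, fun s hs => ?_, ?_⟩
    · have := DFunLike.congr_fun e s
      simpa [hs.ne, (hik.trans hs).ne] using this
    · have := DFunLike.congr_fun e k
      simp [hik.ne] at this
      omega
  by_contra hba
  rcases (not_lt.1 hba).eq_or_lt with rfl | hab
  · exact hlt.asymm hlt
  · exact hlt.asymm (h.1 _ _ hab)

lemma exists_mem_laterNonfull (h : IsRevlexEnumerationOfPow v t w) (ht : 1 ≤ t)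
    {a b : Fin m} (hba : b < a) {c : Fin n →₀ ℕ} (hc : w b ≤ c + w a) :
    ∃ k ∈ laterNonfull t (w a), c k ≠ 0 := by
  obtain ⟨i, hi, hi0, hmin⟩ := exists_minVar_eq (h.ne_zero ht a)
  have hd := (h.degree b).trans (h.degree a).symm
  obtain ⟨l, hl, hlt⟩ : ∃ l : Fin n, (∀ s, l < s → w b s = w a s) ∧ w a l < w b l := by
    rcases h.1 b a hba with h' | h'
    · omega
    · exact h'.2
  have hil : i < l := by
    by_contra hli
    have hle : w a ≤ w b := by
      intro s
      rcases lt_trichotomy l s with h1 | rfl | h1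
      · rw [hl s h1]
      · exact hlt.le
      · rw [hi0 s (h1.trans_le (not_lt.1 hli))]
        exact Nat.zero_le _
    have := eq_of_le_of_degree_eq hle hd.symm
    rw [this] at hlt
    exact lt_irrefl _ hlt
  refine ⟨l, ?_, ?_⟩
  · rw [mem_laterNonfull, hmin]
    have h1 := h.apply_le b l
    have h2 : (i : ℕ) < l := hil
    exact ⟨by omega, by omega⟩
  · have := hc l
    rw [Finsupp.add_apply] at this
    omega

lemma mem_colonIdeal_iff (h : IsRevlexEnumerationOfPow v t w) (ht : 1 ≤ t) (a : Fin m)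
    (f : MvPolynomial (Fin n) K) : f ∈ colonIdeal K w a ↔
      f ∈ varIdeal n K (laterNonfull t (w a) : Set (Fin n)) := by
  rw [EdgeIdeal.mem_colonIdeal_iff, mem_ideal_span_X_image]
  refine forall₂_congr fun c _ => ⟨?_, ?_⟩
  · rintro ⟨b, hba, hb⟩
    exact h.exists_mem_laterNonfull ht hba hb
  · rintro ⟨k, hk, hck⟩
    obtain ⟨b, hba, l, e⟩ := h.exists_lt_of_mem_laterNonfull ht hk
    refine ⟨b, hba, ?_⟩
    calc w b ≤ w b + Finsupp.single l 1 := le_self_add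
      _ = Finsupp.single k 1 + w a := by rw [e, add_comm]
      _ ≤ c + w a := by
        gcongr
        rw [Finsupp.single_le_iff]
        exact Nat.one_le_iff_ne_zero.2 hck

lemma quotientSet_eq (h : IsRevlexEnumerationOfPow v t w) (ht : 1 ≤ t) (a : Fin m) :
    quotientSet K w a = (laterNonfull t (w a) : Set (Fin n)) := by
  ext k
  change (X k : MvPolynomial (Fin n) K) ∈ colonIdeal K w a ↔ _
  rw [h.mem_colonIdeal_iff ht, mem_ideal_span_X_image]
  simp [support_X, Finsupp.single_apply]

lemma bettiNumber_eq (h : IsRevlexEnumerationOfPow v t w) (ht : 1 ≤ t) (i : ℕ) :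
    bettiNumber (Ideal.span ((fun w => monomial w (1 : K)) '' powGens (finalLexsegment v) t)) i =
      ((∑ a : Fin m, (laterNonfull t (w a)).card.choose i : ℕ) : Cardinal.{u}) := by
  let p : ℕ → MvPolynomial (Fin n) K := fun a => if ha : a < m then monomial (w ⟨a, ha⟩) 1 else 0
  let A : ℕ → Finset (Fin n) := fun a => if ha : a < m then laterNonfull t (w ⟨a, ha⟩) else ∅
  have hp : ∀ a : Fin m, p a = monomial (w a) 1 := fun a => by simp [p]
  have hA : ∀ a : Fin m, A a = laterNonfull t (w a) := fun a => by simp [A]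
  have himg : ∀ a : Fin m, p '' Set.Iio (a : ℕ) =
      {f | ∃ b : Fin m, b < a ∧ f = monomial (w b) (1 : K)} := by
    intro a
    ext f
    constructor
    · rintro ⟨b, hb, rfl⟩
      exact ⟨⟨b, lt_trans hb a.2⟩, hb, hp ⟨b, lt_trans hb a.2⟩⟩
    · rintro ⟨b, hb, rfl⟩
      exact ⟨b, hb, hp b⟩
  have htot : p '' Set.Iio m = (fun w => monomial w (1 : K)) '' powGens (finalLexsegment v) t := by
    rw [← h.2, ← Set.range_comp]
    ext f
    constructor
    · rintro ⟨b, hb, rfl⟩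
      exact ⟨⟨b, hb⟩, (hp ⟨b, hb⟩).symm⟩
    · rintro ⟨b, rfl⟩
      exact ⟨b, b.2, hp b⟩
  rw [← htot, bettiNumber_span_of_linearQuotients m p A]
  · rw [Finset.sum_range]
    simp only [hA]
  · intro a ha f
    lift a to Fin m using ha
    rw [hA, ← h.mem_colonIdeal_iff ht, hp, himg, colonIdeal, Ideal.mem_colon_span_singleton]
  · intro a ha k hk
    lift a to Fin m using ha
    rw [hA] at hk
    obtain ⟨b, hba, l, e⟩ := h.exists_lt_of_mem_laterNonfull ht hk
    have : X k * p a = X l * p b := by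
      rw [hp, hp, X, X, monomial_mul, monomial_mul, add_comm, ← e, add_comm]
    rw [this]
    exact Ideal.mul_mem_mul (Ideal.subset_span ⟨l, rfl⟩) (Ideal.subset_span ⟨b, hba, rfl⟩)

end IsRevlexEnumerationOfPow

lemma IsRevlexEnumeration.ofPow {v : Fin n →₀ ℕ} {t m : ℕ} {w : Fin m → Fin n →₀ ℕ}
    (h : IsRevlexEnumeration
      ((Ideal.span ((fun w => monomial w (1 : K)) '' finalLexsegment v)) ^ t) w) :
    IsRevlexEnumerationOfPow v t w := by
  refine ⟨h.1, h.2.trans ?_⟩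
  rw [span_pow_eq_span_powGens]
  exact minGens_span_eq fun a ha => degree_of_mem_powGens (fun _ he => he.1) ha

lemma hasLaterPower_one {w : Fin n →₀ ℕ} (hd : w.degree = 2) (hle : ∀ k, w k ≤ 1) :
    HasLaterPower 1 w := by
  have hw : w ≠ 0 := by rintro rfl; simp at hd
  obtain ⟨i, hi, hi0, hmin⟩ := exists_minVar_eq hw
  obtain ⟨x, hx, e⟩ := IsSqfreeDegTwo.exists_eq ⟨hle, hd⟩ hi
  have hwx : w x ≠ 0 := by rw [e]; simp
  have hix : i < x := lt_of_le_of_ne (not_lt.1 fun hc => hwx (hi0 x hc)) hx.symm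
  refine ⟨x, ?_, ?_⟩
  · have : (i : ℕ) < x := hix
    omega
  · rw [Finsupp.single_le_iff]
    exact Nat.one_le_iff_ne_zero.2 hwx

end Ideals
end EdgeIdeal

open EdgeIdeal in
open scoped Classical in
theorem mainTheorem5 {n : ℕ} {K : Type u} [Field K]
    (I : Ideal (MvPolynomial (Fin n) K)) (hI : IsFinalLexsegmentEdgeIdeal I) :
    (∀ (t m : ℕ) (w : Fin m → Fin n →₀ ℕ), 1 ≤ t → IsRevlexEnumeration (I ^ t) w →
      ∀ a : Fin m,
        colonIdeal K w a = Ideal.span ((X : Fin n → MvPolynomial (Fin n) K) '' quotientSet K w a) ∧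
        ((quotientSet K w a).ncard : ℤ) =
          if HasLaterPower t (w a) then (n : ℤ) - minVar (w a) - 1
          else (n : ℤ) - minVar (w a)) ∧
    (∀ (m : ℕ) (w : Fin m → Fin n →₀ ℕ), IsRevlexEnumeration I w →
      ∀ i : ℕ, bettiNumber I i =
        ((∑ a : Fin m, (n - minVar (w a) - 1).choose i : ℕ) : Cardinal.{u})) ∧
    (∀ (t m : ℕ) (w : Fin m → Fin n →₀ ℕ), 1 < t → IsRevlexEnumeration (I ^ t) w →
      ∀ i : ℕ, bettiNumber (I ^ t) i =
        (((∑ a : Fin m with ¬ HasLaterPower t (w a), (n - minVar (w a)).choose i) +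
          ∑ a : Fin m with HasLaterPower t (w a), (n - minVar (w a) - 1).choose i : ℕ) :
            Cardinal.{u})) := by
  obtain ⟨v, -, rfl⟩ := hI
  have hcard : ∀ {t m : ℕ} {w : Fin m → Fin n →₀ ℕ}, 1 ≤ t → IsRevlexEnumerationOfPow v t w →
      ∀ a, minVar (w a) + (laterNonfull t (w a)).card +
        (if HasLaterPower t (w a) then 1 else 0) = n :=
    fun ht h a => card_laterNonfull ht (h.degree a) (h.apply_le a)
  refine ⟨fun t m w ht hw a => ?_, fun m w hw i => ?_, fun t m w ht hw i => ?_⟩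
  · have h := hw.ofPow
    rw [h.quotientSet_eq ht, Set.ncard_coe_finset]
    refine ⟨Ideal.ext fun f => h.mem_colonIdeal_iff ht a f, ?_⟩
    have := hcard ht h a
    split_ifs at this ⊢ <;> omega
  · rw [← pow_one (Ideal.span _)] at hw ⊢
    have h := hw.ofPow
    rw [span_pow_eq_span_powGens, h.bettiNumber_eq le_rfl]
    refine congrArg _ (Finset.sum_congr rfl fun a _ => ?_)
    have := hcard le_rfl h a
    rw [if_pos (hasLaterPower_one (h.degree a) (h.apply_le a))] at this
    congr 1
    omega
  · have h := hw.ofPow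
    rw [span_pow_eq_span_powGens, h.bettiNumber_eq ht.le,
      ← Finset.sum_filter_not_add_sum_filter _ (fun a => HasLaterPower t (w a))]
    refine congrArg _ (congrArg₂ _ (Finset.sum_congr rfl fun a ha => ?_)
      (Finset.sum_congr rfl fun a ha => ?_))
    all_goals
      have := hcard ht.le h a
      have ha := (Finset.mem_filter.1 ha).2
      simp only [ha, if_true, if_false] at this
      congr 1
      omega
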